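/- Let $d\ge 1$ be an integer and $\mathcal H=\mathbb C^d\otimes\mathbb C^d\otimes\mathbb C^d$ (three qudits). For a vector $\psi\in\mathcal H$ let $$\tau_1(\psi)=\tfrac13\big[\tau_{12|3}(\psi)+\tau_{13|2}(\psi)+\tau_{23|1}(\psi)\big],\qquad \tau_{ab|c}(\psi)=2\Big(1-\operatorname{tr}\big[(\operatorname{tr}_{ab}|\psi\rangle\langle\psi|)^2\big]\Big),$$ be the one-tangle, where $\operatorname{tr}_{ab}$ is the partial trace over the subsystems $a$ and $b$. For a unitary operator $U$ on $\mathcal H$ let the entangling power $\epsilon_1(U)$ be the average of $\tau_1\big(U(\varphi_1\otimes\varphi_2\otimes\varphi_3)\big)$ over independent unit vectors $\varphi_1,\varphi_2,\varphi_3\in\mathbb C^d$, each distributed according to the unitarily invariant probability measure on the unit sphere. Let $$\tilde\epsilon_1=\frac13\sum_{c=1}^3\tilde\epsilon_{ab|c},\qquad \tilde\epsilon_{ab|c}=2-2\Big(\frac{d}{d+1}\Big)^3\bigg[8-\sum_{x'|y'}\frac{\min(d_{abx'},d_{cy'})-1}{\min(d_{abx'},d_{cy'})}\bigg],$$ where $\{a,b,c\}=\{1,2,3\}$,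 the sum runs over all eight ordered splittings $x'\sqcup y'=\{1',2',3'\}$ (empty parts allowed), $d_{abx'}=d^{\,2+|x'|}$ and $d_{cy'}=d^{\,1+|y'|}$. Then: 1. The mean of $\epsilon_1$ over the unitary group $U(d^3)$ with respect to the Haar probability measure is $$\langle\epsilon_1\rangle_{U(d^3)}=2\,\frac{(d-1)^2}{d^2-d+1}.$$ 2. The mean of $\epsilon_1$ over the real orthogonal group $O(d^3)$ (orthogonal matrices in the product basis of $\mathcal H$) with respect to the Haar probability measure is $$\langle\epsilon_1\rangle_{O(d^3)}=2\,\frac{d^3(d+1)^3(d-1)-8(d-1)}{(d^3+2)(d^2+d+1)(d+1)^2}.$$ 3. The maximum of $\epsilon_1$ over $U(d^3)$ exists and is equal to $\tilde\epsilon_1$, and $$\max_{U\in U(d^3)}\epsilon_1(U)=\tilde\epsilon_1=2\,\frac{d^2+d-2}{(1+d)^2}.$$ -/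

import Mathlib

open MeasureTheory
open scoped Matrix

/-! ### Haar averages over compact groups -/

/-- The mean of `f` with respect to the Haar probability measure (on the Borel σ-algebra) of a
compact group `G`. -/
noncomputable def haarMean (G : Type*) [Group G] [TopologicalSpace G] [IsTopologicalGroup G]
    [CompactSpace G] (f : G → ℝ) : ℝ :=
  letI : MeasurableSpace G := borel G
  haveI : BorelSpace G := ⟨rfl⟩
  ∫ g, f g ∂(Measure.haarMeasure (⊤ : TopologicalSpace.PositiveCompacts G))

theorem isCompact_unitaryGroup (ι 𝕜 : Type*) [Fintype ι] [DecidableEq ι] [RCLike 𝕜] :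
    IsCompact (Matrix.unitaryGroup ι 𝕜 : Set (Matrix ι ι 𝕜)) := by
  have hK : IsCompact (Set.pi Set.univ
      (fun _ : ι => Set.pi Set.univ (fun _ : ι => Metric.closedBall (0 : 𝕜) 1))) :=
    isCompact_univ_pi fun _ => isCompact_univ_pi fun _ => isCompact_closedBall _ _
  refine IsCompact.of_isClosed_subset hK ?_ ?_
  · have h : (Matrix.unitaryGroup ι 𝕜 : Set (Matrix ι ι 𝕜)) =
        {A : Matrix ι ι 𝕜 | A * star A = 1} := by
      ext A
      exact Matrix.mem_unitaryGroup_iff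
    rw [h]
    exact isClosed_eq (by fun_prop) continuous_const
  · intro A hA i _ j _
    exact mem_closedBall_zero_iff.mpr (entry_norm_bound_of_unitary hA i j)

instance unitaryGroup_compactSpace (ι 𝕜 : Type*) [Fintype ι] [DecidableEq ι] [RCLike 𝕜] :
    CompactSpace (Matrix.unitaryGroup ι 𝕜) :=
  isCompact_iff_compactSpace.mp (isCompact_unitaryGroup ι 𝕜)

instance orthogonalGroup_compactSpace (ι : Type*) [Fintype ι] [DecidableEq ι] :
    CompactSpace (Matrix.orthogonalGroup ι ℝ) := by
  have h : (Matrix.orthogonalGroup ι ℝ : Set (Matrix ι ι ℝ)) =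
      (Matrix.unitaryGroup ι ℝ : Set (Matrix ι ι ℝ)) := by
    ext A
    exact (Matrix.mem_orthogonalGroup_iff ι ℝ).trans (Matrix.mem_unitaryGroup_iff (A := A)).symm
  have hc : IsCompact (Matrix.orthogonalGroup ι ℝ : Set (Matrix ι ι ℝ)) := by
    rw [h]
    exact isCompact_unitaryGroup ι ℝ
  exact isCompact_iff_compactSpace.mp hc

/-! ### Tripartite pure states and their one-tangle -/

/-- The index set of the product basis `|j₁ j₂ j₃⟩` of `ℂ^d₁ ⊗ ℂ^d₂ ⊗ ℂ^d₃`. -/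
abbrev TripartiteIndex (d₁ d₂ d₃ : ℕ) : Type := Fin d₁ × Fin d₂ × Fin d₃

/-- The operator `|ψ⟩⟨ψ|`. -/
def pureStateMatrix {ι : Type*} (ψ : ι → ℂ) : Matrix ι ι ℂ := Matrix.vecMulVec ψ (star ψ)

/-- The partial trace `tr₁₂` over the first and the second subsystem. -/
def partialTrace12 {d₁ d₂ d₃ : ℕ}
    (ρ : Matrix (TripartiteIndex d₁ d₂ d₃) (TripartiteIndex d₁ d₂ d₃) ℂ) :
    Matrix (Fin d₃) (Fin d₃) ℂ :=
  Matrix.of fun i j => ∑ a, ∑ b, ρ (a, b, i) (a, b, j)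

/-- The partial trace `tr₁₃` over the first and the third subsystem. -/
def partialTrace13 {d₁ d₂ d₃ : ℕ}
    (ρ : Matrix (TripartiteIndex d₁ d₂ d₃) (TripartiteIndex d₁ d₂ d₃) ℂ) :
    Matrix (Fin d₂) (Fin d₂) ℂ :=
  Matrix.of fun i j => ∑ a, ∑ c, ρ (a, i, c) (a, j, c)

/-- The partial trace `tr₂₃` over the second and the third subsystem. -/
def partialTrace23 {d₁ d₂ d₃ : ℕ}
    (ρ : Matrix (TripartiteIndex d₁ d₂ d₃) (TripartiteIndex d₁ d₂ d₃) ℂ) :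
    Matrix (Fin d₁) (Fin d₁) ℂ :=
  Matrix.of fun i j => ∑ b, ∑ c, ρ (i, b, c) (j, b, c)

/-- `2 (1 - tr σ²)`, for a reduced density matrix `σ`; the trace of the square of a density matrix
is real. -/
noncomputable def concurrenceOfReduced {n : ℕ} (σ : Matrix (Fin n) (Fin n) ℂ) : ℝ :=
  2 * (1 - (Matrix.trace (σ * σ)).re)

/-- The one-tangle `τ₁(ψ) = (τ₁₂|₃(ψ) + τ₁₃|₂(ψ) + τ₂₃|₁(ψ)) / 3`, where
`τ_{ab|c}(ψ) = 2 (1 - tr (tr_{ab} |ψ⟩⟨ψ|)²)`. -/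
noncomputable def oneTangle {d₁ d₂ d₃ : ℕ} (ψ : TripartiteIndex d₁ d₂ d₃ → ℂ) : ℝ :=
  (1 / 3) * (concurrenceOfReduced (partialTrace12 (pureStateMatrix ψ))
    + concurrenceOfReduced (partialTrace13 (pureStateMatrix ψ))
    + concurrenceOfReduced (partialTrace23 (pureStateMatrix ψ)))

/-! ### The entangling power -/

/-- The unit vectors of `ℂ^d`. -/
abbrev UnitVector (d : ℕ) : Type := Metric.sphere (0 : EuclideanSpace ℂ (Fin d)) 1

/-- The surface measure of the unit sphere of `ℂ^d`, which is finite and unitarily invariant. -/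
noncomputable def sphereMeasure (d : ℕ) : Measure (UnitVector d) :=
  (volume : Measure (EuclideanSpace ℂ (Fin d))).toSphere

/-- The product vector `φ₁ ⊗ φ₂ ⊗ φ₃`. -/
def productState {d₁ d₂ d₃ : ℕ} (φ : UnitVector d₁ × UnitVector d₂ × UnitVector d₃) :
    TripartiteIndex d₁ d₂ d₃ → ℂ :=
  fun j => φ.1.1 j.1 * φ.2.1.1 j.2.1 * φ.2.2.1 j.2.2

/-- The entangling power `ε₁(U)`: the average of the one-tangle of `U (φ₁ ⊗ φ₂ ⊗ φ₃)` over
independent, uniformly distributed unit vectors `φ₁, φ₂, φ₃` (the average `⨍` normalizes the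
measure to total mass one). -/
noncomputable def entanglingPower {d₁ d₂ d₃ : ℕ}
    (U : Matrix (TripartiteIndex d₁ d₂ d₃) (TripartiteIndex d₁ d₂ d₃) ℂ) : ℝ :=
  ⨍ φ, oneTangle (U *ᵥ productState φ)
    ∂((sphereMeasure d₁).prod ((sphereMeasure d₂).prod (sphereMeasure d₃)))

/-- The number `min(d_{abx'}, d_{cy'})`: `x` is a subset of the copies `1', 2', 3'` of the three
subsystems, `y` is its complement, and `{a, b}` is the complement of `{c}`. -/
def minBipartitionDim (d : Fin 3 → ℕ) (c : Fin 3) (x : Finset (Fin 3)) : ℕ :=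
  min ((∏ i ∈ ({c} : Finset (Fin 3))ᶜ, d i) * ∏ i ∈ x, d i) (d c * ∏ i ∈ xᶜ, d i)

/-- The bound `ε̃_{ab|c}`. -/
noncomputable def bipartitionBound (d : Fin 3 → ℕ) (c : Fin 3) : ℝ :=
  2 - 2 * (∏ i, (d i : ℝ) / ((d i : ℝ) + 1)) *
    (8 - ∑ x : Finset (Fin 3),
      ((minBipartitionDim d c x : ℝ) - 1) / (minBipartitionDim d c x : ℝ))

/-- The bound `ε̃₁ = (ε̃₁₂|₃ + ε̃₁₃|₂ + ε̃₂₃|₁) / 3`. -/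
noncomputable def entanglingPowerBound (d : Fin 3 → ℕ) : ℝ :=
  (1 / 3) * ∑ c, bipartitionBound d c

/-! The purity of a reduction of `ψ` is a quartic expression in `ψ`, so everything reduces to the
fourth moments E[X_i conj(X_j) X_k conj(X_l)] of invariant random unit vectors. Orthogonal
invariance forces these moments to be combinations of the three pairings of the indices
(`fourthMoment_of_isOrthogonallyInvariant`). Invariance under phases kills the pairing (ik)(jl), and
normalization then determines the unitary case completely.

Means. Fubini (`haarMean_entanglingPower`) allows averaging over the group first, with a product
vector ψ held fixed. Over the unitary group, Uψ has the moments of a uniform unit vector in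
dimension d³, so each mean purity is (d² + d)/(d³ + 1) for every ψ. Over the orthogonal group one
invariant of ψ survives, q = |Σ ψ_i²|². The mean one-tangle is affine in q, and q factorizes on
product vectors, with mean (2/(d+1))³.

Maximum. For fixed U, the average over product vectors is taken instead. Averaging over one factor
joins the corresponding input index to either side of the bipartition
(`integral_purity_uniformSphere`). Three such averages turn ε₁(U) into a sum, over the three output
subsystems, of eight purities of U viewed as a tensor with six indices (`entanglingPower_eq`). By
Cauchy–Schwarz each purity is at least ‖U‖⁴ divided by the dimension of either side, and ‖U‖² = d³.
Choosing the smaller side gives the upper bound (`le_re_splitPurity`, `entanglingPower_le`).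
Equality holds when U is unitary and the reductions to one output and two inputs are maximally mixed
(`splitPurity_eq`). The graph state of the triangular prism over ℤ/d provides such a matrix for
every d, because all the adjacency blocks involved have determinant ±1 (`prismMatrix`). -/

set_option linter.unusedSectionVars false

/-! ### Fourth moments of invariant random vectors -/

open ComplexConjugate in
/-- The fourth moment `∫ X_i conj(X_j) X_k conj(X_l)` of a random vector `X`. -/
noncomputable def fourthMoment {Ω ι : Type*} [MeasurableSpace Ω] (μ : Measure Ω) (X : Ω → ι → ℂ)
    (i j k l : ι) : ℂ :=
  ∫ ω, X ω i * conj (X ω j) * (X ω k * conj (X ω l)) ∂μ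

/-- The reflection in the hyperplane orthogonal to `w`. -/
noncomputable def householder {ι : Type*} [Fintype ι] [DecidableEq ι] (w : ι → ℝ) :
    Matrix ι ι ℝ :=
  1 - (2 / (w ⬝ᵥ w)) • Matrix.vecMulVec w w

theorem householder_mem_orthogonalGroup {ι : Type*} [Fintype ι] [DecidableEq ι] {w : ι → ℝ}
    (hw : w ⬝ᵥ w ≠ 0) : householder w ∈ Matrix.orthogonalGroup ι ℝ := by
  rw [Matrix.mem_orthogonalGroup_iff]
  have h1 : star (householder w) = householder w := by
    rw [householder, star_sub, star_one, star_smul]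
    congr 2
    ext i j
    simp [Matrix.vecMulVec_apply, mul_comm]
  have h2 : Matrix.vecMulVec w w * Matrix.vecMulVec w w = (w ⬝ᵥ w) • Matrix.vecMulVec w w := by
    rw [Matrix.vecMulVec_mul_vecMulVec]
    ext i j
    simp [Matrix.vecMulVec_apply]
    ring
  rw [show (householder w)ᵀ = householder w from h1, householder, mul_sub, sub_mul, sub_mul, one_mul, mul_one, one_mul, smul_mul_smul_comm, h2,
    smul_smul]
  have h3 : 2 / (w ⬝ᵥ w) * (2 / (w ⬝ᵥ w)) * (w ⬝ᵥ w) = 2 / (w ⬝ᵥ w) + 2 / (w ⬝ᵥ w) := by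
    field_simp
    norm_num
  rw [h3, add_smul]
  abel

theorem householder_map_mulVec {ι : Type*} [Fintype ι] [DecidableEq ι] (w : ι → ℝ) (x : ι → ℂ)
    (i : ι) : ((householder w).map (fun r : ℝ => (r : ℂ)) *ᵥ x) i =
      x i - 2 / ((w ⬝ᵥ w : ℝ) : ℂ) * (∑ k, (w k : ℂ) * x k) * w i := by
  have : (householder w).map (fun r : ℝ => (r : ℂ)) =
      1 - (2 / ((w ⬝ᵥ w : ℝ) : ℂ)) • Matrix.vecMulVec (fun i => (w i : ℂ)) (fun i => (w i : ℂ)) := by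
    ext a b
    by_cases h : a = b <;> simp [householder, Matrix.vecMulVec_apply, h]
  rw [this, Matrix.sub_mulVec, Matrix.one_mulVec, Matrix.smul_mulVec]
  simp [Matrix.vecMulVec_mulVec, dotProduct]
  ring

theorem sum_ofReal_single_mul {ι : Type*} [Fintype ι] [DecidableEq ι] (p : ι) (r : ℝ) (x : ι → ℂ) :
    ∑ k, (((Pi.single p r : ι → ℝ) k : ℝ) : ℂ) * x k = r * x p := by
  rw [Finset.sum_eq_single p]
  · simp
  · intro b _ hb
    simp [hb]
  · simp

theorem householder_single {ι : Type*} [Fintype ι] [DecidableEq ι] (p : ι) (x : ι → ℂ) (i : ι) :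
    ((householder (Pi.single p 1)).map (fun r : ℝ => (r : ℂ)) *ᵥ x) i =
      (if i = p then -1 else 1) * x i := by
  rw [householder_map_mulVec]
  by_cases h : i = p
  · subst h
    simp [sum_ofReal_single_mul]
    ring
  · simp [Pi.single_apply, h]

theorem householder_sub {ι : Type*} [Fintype ι] [DecidableEq ι] {p q : ι} (hpq : p ≠ q)
    (x : ι → ℂ) (i : ι) :
    ((householder (Pi.single p 1 - Pi.single q 1)).map (fun r : ℝ => (r : ℂ)) *ᵥ x) i =
      x (Equiv.swap p q i) := by
  rw [householder_map_mulVec]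
  have hqp := hpq.symm
  by_cases h : i = p
  · subst h
    simp [sub_mul, Finset.sum_sub_distrib, sum_ofReal_single_mul, hpq, hqp]
    ring
  · by_cases h' : i = q
    · subst h'
      simp [sub_mul, Finset.sum_sub_distrib, sum_ofReal_single_mul, hpq, hqp]
      ring
    · simp [Pi.single_apply, h, h', Equiv.swap_apply_of_ne_of_ne h h']

/-- Sign changes and transpositions do not relate the diagonal moment to the others; a reflection
mixing two coordinates is needed. The vector e_p - 2e_q gives the rational coefficients 3/5 and 4/5,
avoiding square roots. -/
theorem householder_sub_two {ι : Type*} [Fintype ι] [DecidableEq ι] {p q : ι} (hpq : p ≠ q)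
    (x : ι → ℂ) :
    ((householder (Pi.single p 1 - Pi.single q 2)).map (fun r : ℝ => (r : ℂ)) *ᵥ x) p =
      ∑ s : Fin 2, (![3 / 5, 4 / 5] s : ℝ) * x (![p, q] s) := by
  rw [householder_map_mulVec]
  have hqp := hpq.symm
  simp [sub_mul, Finset.sum_sub_distrib, sum_ofReal_single_mul, hpq, hqp]
  ring

open ComplexConjugate in
theorem continuous_quartic {ι : Type*} (i j k l : ι) :
    Continuous fun x : ι → ℂ => x i * conj (x j) * (x k * conj (x l)) :=
  ((continuous_apply i).mul (Complex.continuous_conj.comp (continuous_apply j))).mul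
    ((continuous_apply k).mul (Complex.continuous_conj.comp (continuous_apply l)))

section Moments

variable {Ω ι : Type*} [TopologicalSpace Ω] [CompactSpace Ω] [MeasurableSpace Ω]
  [OpensMeasurableSpace Ω] {μ : Measure Ω} [IsFiniteMeasure μ] {X : Ω → ι → ℂ}

theorem Continuous.integrable_of_compactSpace {E : Type*} [NormedAddCommGroup E] {f : Ω → E}
    (hf : Continuous f) : Integrable f μ :=
  hf.integrable_of_hasCompactSupport (HasCompactSupport.of_compactSpace f)

open ComplexConjugate in
theorem integral_mul_conj_sum (hX : Continuous X) {σ : Type*} [Fintype σ] (c : σ → ℝ) (g : σ → ι) :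
    ∫ ω, (∑ s, (c s : ℂ) * X ω (g s)) * conj (∑ s, (c s : ℂ) * X ω (g s)) *
      ((∑ s, (c s : ℂ) * X ω (g s)) * conj (∑ s, (c s : ℂ) * X ω (g s))) ∂μ =
    ∑ s, ∑ t, ∑ u, ∑ v, (c s * c t * c u * c v : ℂ) *
      fourthMoment μ X (g s) (g t) (g u) (g v) := by
  have hc : ∀ i, Continuous fun ω => X ω i := fun i => (continuous_apply i).comp hX
  have hc' : ∀ i, Continuous fun ω => conj (X ω i) := fun i => Complex.continuous_conj.comp (hc i)
  have key : ∀ ω, (∑ s, (c s : ℂ) * X ω (g s)) * conj (∑ s, (c s : ℂ) * X ω (g s)) *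
      ((∑ s, (c s : ℂ) * X ω (g s)) * conj (∑ s, (c s : ℂ) * X ω (g s))) =
      ∑ s, ∑ t, ∑ u, ∑ v, (c s * c t * c u * c v : ℂ) *
        (X ω (g s) * conj (X ω (g t)) * (X ω (g u) * conj (X ω (g v)))) := by
    intro ω
    simp only [map_sum, map_mul, Complex.conj_ofReal, Finset.sum_mul_sum]
    refine Finset.sum_congr rfl fun s _ => ?_
    rw [Finset.sum_comm]
    refine Finset.sum_congr rfl fun t _ => Finset.sum_congr rfl fun u _ =>
      Finset.sum_congr rfl fun v _ => ?_
    ring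
  simp only [key]
  have hi : ∀ s t u v, Integrable (fun ω => (c s * c t * c u * c v : ℂ) *
        (X ω (g s) * conj (X ω (g t)) * (X ω (g u) * conj (X ω (g v))))) μ := fun s t u v =>
    (Continuous.integrable_of_compactSpace
      (((hc _).mul (hc' _)).mul ((hc _).mul (hc' _)))).const_mul _
  rw [integral_finsetSum _ fun s _ => integrable_finsetSum _ fun t _ =>
    integrable_finsetSum _ fun u _ => integrable_finsetSum _ fun v _ => hi s t u v]
  refine Finset.sum_congr rfl fun s _ => ?_
  rw [integral_finsetSum _ fun t _ =>
    integrable_finsetSum _ fun u _ => integrable_finsetSum _ fun v _ => hi s t u v]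
  refine Finset.sum_congr rfl fun t _ => ?_
  rw [integral_finsetSum _ fun u _ => integrable_finsetSum _ fun v _ => hi s t u v]
  refine Finset.sum_congr rfl fun u _ => ?_
  rw [integral_finsetSum _ fun v _ => hi s t u v]
  refine Finset.sum_congr rfl fun v _ => ?_
  rw [integral_const_mul, fourthMoment]

variable [Fintype ι] [DecidableEq ι]

/-- All continuous functions of `X` have the same mean as the functions of `V X`, for every real
orthogonal matrix `V`. -/
def IsOrthogonallyInvariant (μ : Measure Ω) (X : Ω → ι → ℂ) : Prop :=
  ∀ V ∈ Matrix.orthogonalGroup ι ℝ, ∀ f : (ι → ℂ) → ℂ, Continuous f →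
    ∫ ω, f (V.map (fun r : ℝ => (r : ℂ)) *ᵥ X ω) ∂μ = ∫ ω, f (X ω) ∂μ

/-- All continuous functions of `X` have the same mean as the functions of `V X`, for every
unitary matrix `V`. -/
def IsUnitarilyInvariant (μ : Measure Ω) (X : Ω → ι → ℂ) : Prop :=
  ∀ V ∈ Matrix.unitaryGroup ι ℂ, ∀ f : (ι → ℂ) → ℂ, Continuous f →
    ∫ ω, f (V *ᵥ X ω) ∂μ = ∫ ω, f (X ω) ∂μ

theorem map_ofReal_mem_unitaryGroup {V : Matrix ι ι ℝ} (hV : V ∈ Matrix.orthogonalGroup ι ℝ) :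
    V.map (fun r : ℝ => (r : ℂ)) ∈ Matrix.unitaryGroup ι ℂ := by
  rw [Matrix.mem_orthogonalGroup_iff] at hV
  rw [Matrix.mem_unitaryGroup_iff]
  ext i j
  have := congrArg (fun M : Matrix ι ι ℝ => ((M i j : ℝ) : ℂ)) hV
  simp only [Matrix.mul_apply, Matrix.transpose_apply] at this
  rw [Matrix.mul_apply]
  simp only [Matrix.map_apply, Matrix.star_apply, Complex.star_def, Complex.conj_ofReal]
  push_cast at this
  rw [this]
  by_cases h : i = j <;> simp [Matrix.one_apply, h]

theorem IsUnitarilyInvariant.isOrthogonallyInvariant (h : IsUnitarilyInvariant μ X) :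
    IsOrthogonallyInvariant μ X :=
  fun _ hV => h _ (map_ofReal_mem_unitaryGroup hV)

theorem fourthMoment_sign (h : IsOrthogonallyInvariant μ X) (p i j k l : ι) :
    fourthMoment μ X i j k l = ((if i = p then -1 else 1) * (if j = p then -1 else 1) *
      (if k = p then -1 else 1) * (if l = p then -1 else 1)) * fourthMoment μ X i j k l := by
  conv_lhs => rw [fourthMoment]
  rw [← h _ (householder_mem_orthogonalGroup (w := Pi.single p 1) (by simp)) _
    (continuous_quartic i j k l), fourthMoment, ← integral_const_mul]
  refine integral_congr_ae (Filter.Eventually.of_forall fun ω => ?_)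
  simp only [householder_single, map_mul, apply_ite (starRingEnd ℂ), map_neg, map_one]
  ring

theorem fourthMoment_swap (h : IsOrthogonallyInvariant μ X) (p q i j k l : ι) :
    fourthMoment μ X (Equiv.swap p q i) (Equiv.swap p q j) (Equiv.swap p q k) (Equiv.swap p q l) =
      fourthMoment μ X i j k l := by
  by_cases hpq : p = q
  · simp [hpq]
  conv_rhs => rw [fourthMoment]
  rw [← h _ (householder_mem_orthogonalGroup (w := Pi.single p 1 - Pi.single q 1)
    (by norm_num [hpq, Ne.symm hpq])) _ (continuous_quartic i j k l), fourthMoment]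
  simp only [householder_sub hpq]

/-- Flipping the sign of coordinate `p` kills every moment in which `p` occurs an odd number of
times. -/
theorem fourthMoment_eq_zero_of_sign (h : IsOrthogonallyInvariant μ X) (p i j k l : ι)
    (hs : ((if i = p then -1 else 1) * (if j = p then -1 else 1) *
      (if k = p then -1 else 1) * (if l = p then -1 else 1) : ℂ) = -1) :
    fourthMoment μ X i j k l = 0 := by
  have := fourthMoment_sign h p i j k l
  rw [hs] at this
  linear_combination (1 / 2 : ℂ) * this

/-- Compare E|X_p|⁴ with E|(3/5)X_p + (4/5)X_q|⁴: the odd terms vanish by sign changes, and the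
remaining ones are identified by swapping `p` and `q`. -/
theorem fourthMoment_diag_eq (hX : Continuous X) (h : IsOrthogonallyInvariant μ X) {p q : ι}
    (hpq : p ≠ q) :
    fourthMoment μ X p p p p =
      2 * fourthMoment μ X p p q q + fourthMoment μ X p q p q := by
  have hqp := hpq.symm
  have z := fun r i j k l => fourthMoment_eq_zero_of_sign h r i j k l
  have s := fun i j k l => fourthMoment_swap h p q i j k l
  have e : fourthMoment μ X p p p p = ∑ s, ∑ t, ∑ u, ∑ v,
      ((![3 / 5, 4 / 5] : Fin 2 → ℝ) s * (![3 / 5, 4 / 5] : Fin 2 → ℝ) t *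
        (![3 / 5, 4 / 5] : Fin 2 → ℝ) u * (![3 / 5, 4 / 5] : Fin 2 → ℝ) v : ℂ) *
      fourthMoment μ X (![p, q] s) (![p, q] t) (![p, q] u) (![p, q] v) := by
    rw [← integral_mul_conj_sum hX, fourthMoment,
      ← h _ (householder_mem_orthogonalGroup (w := Pi.single p 1 - Pi.single q 2)
    (by norm_num [hpq, Ne.symm hpq])) _ (continuous_quartic p p p p)]
    simp only [householder_sub_two hpq]
  simp only [Fin.sum_univ_two, Matrix.cons_val_zero, Matrix.cons_val_one] at e
  rw [z q p p p q (by simp [hpq]), z q p p q p (by simp [hpq]), z q p q p p (by simp [hpq]),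
    z q q p p p (by simp [hpq]), z p q q q p (by simp [hqp]), z p q q p q (by simp [hqp]),
    z p q p q q (by simp [hqp]), z p p q q q (by simp [hqp])] at e
  have s1 := s p p p p
  have s2 := s p p q q
  have s3 := s p q p q
  have s4 := s p q q p
  simp only [Equiv.swap_apply_left, Equiv.swap_apply_right] at s1 s2 s3 s4
  have s5 : fourthMoment μ X p q q p = fourthMoment μ X p p q q := by
    simp only [fourthMoment]
    congr 1
    ext ω
    ring
  rw [s1, s2, s3, s4, s5] at e
  push_cast at e
  -- The diagonal terms contribute (81 + 256)/625, leaving 288/625 on the left; each of the six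
  -- mixed terms has coefficient 144/625.
  linear_combination (625 / 288 : ℂ) * e

/-- A function of two indices that is invariant under transpositions is constant off the
diagonal. -/
theorem eq_of_swap_invariant {α : Type*} {g : ι → ι → α}
    (hg : ∀ p q i j, g (Equiv.swap p q i) (Equiv.swap p q j) = g i j) {i j k l : ι} (hij : i ≠ j)
    (hkl : k ≠ l) : g i j = g k l := by
  have h1 := hg i k i j
  have h2 := hg (Equiv.swap i k j) l (Equiv.swap i k i) (Equiv.swap i k j)
  rw [← h1, ← h2, Equiv.swap_apply_left, Equiv.swap_apply_left, Equiv.swap_apply_of_ne_of_ne _ hkl]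
  intro e
  apply hij
  have := congrArg (Equiv.swap i k) e
  simpa using this

theorem fourthMoment_of_isOrthogonallyInvariant (hX : Continuous X)
    (h : IsOrthogonallyInvariant μ X) :
    ∃ β γ : ℂ, ∀ i j k l, fourthMoment μ X i j k l =
      β * ((if i = j then 1 else 0) * (if k = l then 1 else 0) +
        (if i = l then 1 else 0) * (if k = j then 1 else 0)) +
      γ * ((if i = k then 1 else 0) * (if j = l then 1 else 0)) := by
  by_cases hsub : Subsingleton ι
  · by_cases hne : Nonempty ι
    · obtain ⟨a⟩ := hne
      -- In dimension one the three pairings coincide, so only 2β + γ is determined.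
      refine ⟨fourthMoment μ X a a a a / 2, 0, fun i j k l => ?_⟩
      obtain rfl := Subsingleton.elim a i
      obtain rfl := Subsingleton.elim a j
      obtain rfl := Subsingleton.elim a k
      obtain rfl := Subsingleton.elim a l
      simp
      ring
    · exact ⟨0, 0, fun i => (hne ⟨i⟩).elim⟩
  rw [not_subsingleton_iff_nontrivial] at hsub
  obtain ⟨p, q, hpq⟩ := exists_pair_ne ι
  have z := fun r i j k l => fourthMoment_eq_zero_of_sign h r i j k l
  have hb : ∀ i j, i ≠ j → fourthMoment μ X i i j j = fourthMoment μ X p p q q := fun i j hij =>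
    eq_of_swap_invariant (g := fun i j => fourthMoment μ X i i j j)
      (fun p q i j => fourthMoment_swap h p q i i j j) hij hpq
  have hc : ∀ i j, i ≠ j → fourthMoment μ X i j i j = fourthMoment μ X p q p q := fun i j hij =>
    eq_of_swap_invariant (g := fun i j => fourthMoment μ X i j i j)
      (fun p q i j => fourthMoment_swap h p q i j i j) hij hpq
  have hb' : ∀ i j, i ≠ j → fourthMoment μ X i j j i = fourthMoment μ X p p q q := by
    intro i j hij
    rw [← hb i j hij]
    simp only [fourthMoment]
    congr 1
    ext ω
    ring
  have ha : ∀ i, fourthMoment μ X i i i i =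
      2 * fourthMoment μ X p p q q + fourthMoment μ X p q p q := by
    intro i
    obtain ⟨j, hj⟩ := exists_ne i
    rw [fourthMoment_diag_eq hX h hj.symm, hb i j hj.symm, hc i j hj.symm]
  refine ⟨fourthMoment μ X p p q q, fourthMoment μ X p q p q, fun i j k l => ?_⟩
  by_cases hij : i = j
  · subst hij
    by_cases hkl : k = l
    · subst hkl
      by_cases hik : i = k
      · subst hik
        rw [ha]
        simp
        ring
      · rw [hb i k hik]
        simp [hik]
    · by_cases hik : i = k
      · subst hik
        rw [z l i i i l (by simp [hkl])]
        simp [hkl]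
      · rw [z k i i k l (by simp [hik, Ne.symm hkl])]
        simp [hkl, hik, Ne.symm hik]
  · by_cases hkl : k = l
    · subst hkl
      by_cases hik : i = k
      · subst hik
        rw [z j i j i i (by simp [hij])]
        simp [hij, Ne.symm hij]
      · rw [z i i j k k (by simp [Ne.symm hik, Ne.symm hij])]
        simp [hij, hik]
    · by_cases hik : i = k
      · subst hik
        by_cases hjl : j = l
        · subst hjl
          rw [hc i j hij]
          simp [hij]
        · rw [z j i j i l (by simp [hij, Ne.symm hjl])]
          simp [hij, hjl, hkl]
      · by_cases hil : i = l
        · subst hil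
          by_cases hjk : j = k
          · subst hjk
            rw [hb' i j hij]
            simp [hij]
          · rw [z j i j k i (by simp [hij, Ne.symm hjk])]
            simp [hij, hik, Ne.symm hjk]
        · rw [z i i j k l (by simp [Ne.symm hij, Ne.symm hik, Ne.symm hil])]
          simp [hij, hik, hil]

theorem fourthMoment_of_isUnitarilyInvariant (hX : Continuous X)
    (h : IsUnitarilyInvariant μ X) :
    ∃ β : ℂ, ∀ i j k l, fourthMoment μ X i j k l =
      β * ((if i = j then 1 else 0) * (if k = l then 1 else 0) +
        (if i = l then 1 else 0) * (if k = j then 1 else 0)) := by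
  obtain ⟨β, γ, hβ⟩ := fourthMoment_of_isOrthogonallyInvariant hX h.isOrthogonallyInvariant
  by_cases hsub : Subsingleton ι
  · refine ⟨β + γ / 2, fun i j k l => ?_⟩
    rw [hβ]
    obtain rfl := Subsingleton.elim i j
    obtain rfl := Subsingleton.elim i k
    obtain rfl := Subsingleton.elim i l
    simp
    ring
  rw [not_subsingleton_iff_nontrivial] at hsub
  obtain ⟨p, q, hpq⟩ := exists_pair_ne ι
  have h1 : fourthMoment μ X p q p q = γ := by simp [hβ, hpq]
  have h2 : fourthMoment μ X p q p q = -γ := by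
    -- Multiplying X_p by the phase i multiplies E[X_p² conj(X_q)²] by i² = -1.
    have hD : Matrix.diagonal (fun i => if i = p then Complex.I else 1) ∈
        Matrix.unitaryGroup ι ℂ := by
      rw [Matrix.mem_unitaryGroup_iff, Matrix.star_eq_conjTranspose, Matrix.diagonal_conjTranspose,
        Matrix.diagonal_mul_diagonal, ← Matrix.diagonal_one]
      congr 1
      ext i
      by_cases hi : i = p <;> simp [hi]
    rw [← h1]
    conv_lhs => rw [fourthMoment]
    rw [← h _ hD _ (continuous_quartic p q p q), fourthMoment, ← integral_neg]
    refine integral_congr_ae (Filter.Eventually.of_forall fun ω => ?_)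
    simp only [Matrix.mulVec_diagonal, if_true, hpq.symm, if_false, one_mul]
    linear_combination (X ω p * X ω p * (starRingEnd ℂ) (X ω q) * (starRingEnd ℂ) (X ω q)) *
      Complex.I_sq
  have h3 : γ = 0 := by linear_combination (1 / 2 : ℂ) * (h2 - h1)
  exact ⟨β, fun i j k l => by rw [hβ, h3]; ring⟩

open ComplexConjugate in
theorem sum_fourthMoment_diag [IsProbabilityMeasure μ] (hX : Continuous X)
    (hn : ∀ ω, ∑ i, X ω i * conj (X ω i) = 1) :
    ∑ i, ∑ k, fourthMoment μ X i i k k = 1 := by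
  have hi : ∀ i k, Integrable (fun ω => X ω i * conj (X ω i) * (X ω k * conj (X ω k))) μ :=
    fun i k => Continuous.integrable_of_compactSpace ((continuous_quartic i i k k).comp hX)
  simp only [fourthMoment]
  have : ∀ i, ∑ k, ∫ ω, X ω i * conj (X ω i) * (X ω k * conj (X ω k)) ∂μ =
      ∫ ω, ∑ k, X ω i * conj (X ω i) * (X ω k * conj (X ω k)) ∂μ := fun i =>
    (integral_finsetSum _ fun k _ => hi i k).symm
  simp only [this]
  rw [← integral_finsetSum _ fun i _ => integrable_finsetSum _ fun k _ => hi i k]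
  simp only [← Finset.sum_mul_sum, hn]
  simp

open ComplexConjugate in
-- Contracting along the third pairing produces |Σ X_i²|², the second invariant besides the norm.
-- Together with the normalization this determines β and γ in the orthogonal case when the dimension
-- is at least two.
theorem sum_fourthMoment_cross (hX : Continuous X) :
    ∑ i, ∑ k, fourthMoment μ X i k i k =
      ∫ ω, (∑ i, X ω i * X ω i) * conj (∑ i, X ω i * X ω i) ∂μ := by
  have hi : ∀ i k, Integrable (fun ω => X ω i * conj (X ω k) * (X ω i * conj (X ω k))) μ :=
    fun i k => Continuous.integrable_of_compactSpace ((continuous_quartic i k i k).comp hX)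
  simp only [fourthMoment]
  have : ∀ i, ∑ k, ∫ ω, X ω i * conj (X ω k) * (X ω i * conj (X ω k)) ∂μ =
      ∫ ω, ∑ k, X ω i * conj (X ω k) * (X ω i * conj (X ω k)) ∂μ := fun i =>
    (integral_finsetSum _ fun k _ => hi i k).symm
  simp only [this]
  rw [← integral_finsetSum _ fun i _ => integrable_finsetSum _ fun k _ => hi i k]
  congr 1
  ext ω
  rw [map_sum, Finset.sum_mul_sum]
  refine Finset.sum_congr rfl fun i _ => Finset.sum_congr rfl fun k _ => ?_
  rw [map_mul]
  ring

open ComplexConjugate in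
/-- The fourth moments of a unitarily invariant random unit vector. -/
theorem fourthMoment_eq_of_isUnitarilyInvariant [IsProbabilityMeasure μ] (hX : Continuous X)
    (h : IsUnitarilyInvariant μ X) (hn : ∀ ω, ∑ i, X ω i * conj (X ω i) = 1) (i j k l : ι) :
    fourthMoment μ X i j k l =
      (((Fintype.card ι : ℂ) * (Fintype.card ι + 1))⁻¹) *
      ((if i = j then 1 else 0) * (if k = l then 1 else 0) +
        (if i = l then 1 else 0) * (if k = j then 1 else 0)) := by
  obtain ⟨β, hβ⟩ := fourthMoment_of_isUnitarilyInvariant hX h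
  have h1 := sum_fourthMoment_diag (μ := μ) hX hn
  simp only [hβ] at h1
  have h2 : β * ((Fintype.card ι : ℂ) * (Fintype.card ι + 1)) = 1 := by
    refine Eq.trans ?_ h1
    simp [← Finset.mul_sum, Finset.sum_add_distrib]
    ring
  rw [hβ, eq_inv_of_mul_eq_one_left h2]

open ComplexConjugate in
/-- The fourth moments of an orthogonally invariant random unit vector. -/
theorem fourthMoment_eq_of_isOrthogonallyInvariant [IsProbabilityMeasure μ] (hX : Continuous X)
    (h : IsOrthogonallyInvariant μ X) (hn : ∀ ω, ∑ i, X ω i * conj (X ω i) = 1) :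
    ∃ β γ : ℂ, (Fintype.card ι : ℂ) * (Fintype.card ι + 1) * β + Fintype.card ι * γ = 1 ∧
      2 * (Fintype.card ι : ℂ) * β + Fintype.card ι ^ 2 * γ =
        ∫ ω, (∑ i, X ω i * X ω i) * conj (∑ i, X ω i * X ω i) ∂μ ∧
      ∀ i j k l, fourthMoment μ X i j k l =
        β * ((if i = j then 1 else 0) * (if k = l then 1 else 0) +
          (if i = l then 1 else 0) * (if k = j then 1 else 0)) +
        γ * ((if i = k then 1 else 0) * (if j = l then 1 else 0)) := by
  obtain ⟨β, γ, hβ⟩ := fourthMoment_of_isOrthogonallyInvariant hX h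
  refine ⟨β, γ, ?_, ?_, hβ⟩
  · refine Eq.trans ?_ (sum_fourthMoment_diag (μ := μ) hX hn)
    simp [hβ, ← Finset.mul_sum, Finset.sum_add_distrib]
    ring
  · rw [← sum_fourthMoment_cross (μ := μ) hX]
    simp [hβ, ← Finset.mul_sum, Finset.sum_add_distrib]
    ring

end Moments

/-! ### Averages over products of spheres -/

open ComplexConjugate in
theorem sum_mulVec_mul_conj {ι : Type*} [Fintype ι] [DecidableEq ι] {V : Matrix ι ι ℂ}
    (hV : V ∈ Matrix.unitaryGroup ι ℂ) (x : ι → ℂ) :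
    ∑ i, (V *ᵥ x) i * conj ((V *ᵥ x) i) = ∑ i, x i * conj (x i) := by
  have h : ∀ y : ι → ℂ, ∑ i, y i * conj (y i) = y ⬝ᵥ star y := fun y => rfl
  rw [h, h, Matrix.star_mulVec, dotProduct_comm, ← Matrix.dotProduct_mulVec,
    Matrix.mulVec_mulVec, ← Matrix.star_eq_conjTranspose, Matrix.mem_unitaryGroup_iff'.mp hV,
    Matrix.one_mulVec, dotProduct_comm]

open ComplexConjugate in
theorem EuclideanSpace.norm_sq_eq_sum_mul_conj {ι : Type*} [Fintype ι]
    (x : EuclideanSpace ℂ ι) : ((‖x‖ ^ 2 : ℝ) : ℂ) = ∑ i, x i * conj (x i) := by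
  rw [EuclideanSpace.norm_sq_eq]
  push_cast
  refine Finset.sum_congr rfl fun i _ => ?_
  rw [Complex.mul_conj, Complex.normSq_eq_norm_sq]
  push_cast
  rfl

/-- A unitary matrix as a linear isometry of the Euclidean space. -/
noncomputable def unitaryIsometryEquiv {ι : Type*} [Fintype ι] [DecidableEq ι] (V : Matrix ι ι ℂ)
    (hV : V ∈ Matrix.unitaryGroup ι ℂ) : EuclideanSpace ℂ ι ≃ₗᵢ[ℝ] EuclideanSpace ℂ ι where
  toFun x := WithLp.toLp 2 (V *ᵥ x.ofLp)
  invFun x := WithLp.toLp 2 (star V *ᵥ x.ofLp)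
  map_add' x y := by simp [Matrix.mulVec_add]
  map_smul' c x := by simp [Matrix.mulVec_smul]
  left_inv x := by simp [Matrix.mulVec_mulVec, Matrix.mem_unitaryGroup_iff'.mp hV]
  right_inv x := by simp [Matrix.mulVec_mulVec, Matrix.mem_unitaryGroup_iff.mp hV]
  norm_map' x := by
    have h : ‖WithLp.toLp 2 (V *ᵥ x.ofLp)‖ ^ 2 = ‖x‖ ^ 2 := by
      have := sum_mulVec_mul_conj hV x.ofLp
      rw [← EuclideanSpace.norm_sq_eq_sum_mul_conj x,
        ← EuclideanSpace.norm_sq_eq_sum_mul_conj (WithLp.toLp 2 (V *ᵥ x.ofLp))] at this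
      exact_mod_cast this
    exact (sq_eq_sq₀ (norm_nonneg _) (norm_nonneg _)).mp h

/-- The restriction of a linear isometry to the unit sphere. -/
def sphereMap {E : Type*} [NormedAddCommGroup E] [NormedSpace ℝ E] (e : E ≃ₗᵢ[ℝ] E)
    (x : Metric.sphere (0 : E) 1) : Metric.sphere (0 : E) 1 :=
  ⟨e x.1, by rw [mem_sphere_zero_iff_norm, e.norm_map]; exact norm_eq_of_mem_sphere x⟩

open scoped Pointwise in
-- The surface measure of a set is a multiple of the volume of the cone over it, and a linear
-- isometry preserves volume and carries cones to cones.
theorem measurePreserving_sphereMap {E : Type*} [NormedAddCommGroup E] [InnerProductSpace ℝ E]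
    [FiniteDimensional ℝ E] [MeasurableSpace E] [BorelSpace E] (e : E ≃ₗᵢ[ℝ] E) :
    MeasurePreserving (sphereMap e) (volume : Measure E).toSphere (volume : Measure E).toSphere := by
  have hm : Measurable (sphereMap e) :=
    ((e.continuous.comp continuous_subtype_val).subtype_mk _).measurable
  refine ⟨hm, ?_⟩
  ext s hs
  rw [Measure.map_apply hm hs, Measure.toSphere_apply' _ (hm hs), Measure.toSphere_apply' _ hs]
  congr 1
  rw [← e.measurePreserving.measure_preimage_emb e.toHomeomorph.measurableEmbedding
    (Set.Ioo (0 : ℝ) 1 • (Subtype.val '' s))]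
  congr 1
  ext x
  simp only [Set.mem_preimage, Set.mem_smul, Set.mem_image]
  constructor
  · rintro ⟨r, hr, _, ⟨y, hy, rfl⟩, rfl⟩
    exact ⟨r, hr, _, ⟨_, hy, rfl⟩, (e.map_smul r _).symm⟩
  · rintro ⟨r, hr, _, ⟨y, hy, rfl⟩, h⟩
    have hy' : sphereMap e (sphereMap e.symm y) = y := Subtype.ext (e.apply_symm_apply _)
    refine ⟨r, hr, _, ⟨sphereMap e.symm y, ?_, rfl⟩, ?_⟩
    · rwa [hy']
    · apply e.injective
      rw [← h, map_smul]
      exact congrArg (r • ·) (e.apply_symm_apply y.1)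

instance isFiniteMeasure_sphereMeasure (d : ℕ) : IsFiniteMeasure (sphereMeasure d) := by
  unfold sphereMeasure
  infer_instance

theorem neZero_sphereMeasure {d : ℕ} (hd : 1 ≤ d) : NeZero (sphereMeasure d) := by
  have : Nonempty (Fin d) := ⟨⟨0, hd⟩⟩
  exact ⟨Measure.toSphere_ne_zero _⟩

/-- The uniform probability measure on the unit sphere of `ℂ^d`. -/
noncomputable def uniformSphere (d : ℕ) : Measure (UnitVector d) :=
  (sphereMeasure d Set.univ)⁻¹ • sphereMeasure d

instance isFiniteMeasure_uniformSphere (d : ℕ) : IsFiniteMeasure (uniformSphere d) := by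
  unfold uniformSphere
  infer_instance

theorem isProbabilityMeasure_uniformSphere {d : ℕ} (hd : 1 ≤ d) :
    IsProbabilityMeasure (uniformSphere d) := by
  have := neZero_sphereMeasure hd
  unfold uniformSphere
  infer_instance

theorem average_prod {α β E : Type*} [MeasurableSpace α] [MeasurableSpace β] [NormedAddCommGroup E]
    [NormedSpace ℝ E] {μ : Measure α} {ν : Measure β} [IsFiniteMeasure μ] [IsFiniteMeasure ν]
    {f : α × β → E} (hf : Integrable f (μ.prod ν)) :
    ⨍ z, f z ∂(μ.prod ν) = ⨍ x, ⨍ y, f (x, y) ∂ν ∂μ := by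
  simp only [average_eq]
  rw [integral_prod _ hf, integral_smul, smul_smul, ← Set.univ_prod_univ, measureReal_prod_prod,
    mul_inv]

/-- The joint law of three independent uniformly distributed unit vectors. -/
noncomputable def uniformSphereTriple (d : ℕ) :
    Measure (UnitVector d × UnitVector d × UnitVector d) :=
  (uniformSphere d).prod ((uniformSphere d).prod (uniformSphere d))

instance isFiniteMeasure_uniformSphereTriple (d : ℕ) : IsFiniteMeasure (uniformSphereTriple d) := by
  unfold uniformSphereTriple
  infer_instance

theorem isProbabilityMeasure_uniformSphereTriple {d : ℕ} (hd : 1 ≤ d) :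
    IsProbabilityMeasure (uniformSphereTriple d) := by
  have := isProbabilityMeasure_uniformSphere hd
  unfold uniformSphereTriple
  infer_instance

theorem integral_uniformSphereTriple {E : Type*} [NormedAddCommGroup E] [NormedSpace ℝ E] {d : ℕ}
    {f : UnitVector d × UnitVector d × UnitVector d → E} (hf : Continuous f) :
    ∫ φ, f φ ∂(uniformSphereTriple d) =
      ∫ x, ∫ y, ∫ z, f (x, y, z) ∂(uniformSphere d) ∂(uniformSphere d) ∂(uniformSphere d) := by
  rw [uniformSphereTriple, integral_prod _ (Continuous.integrable_of_compactSpace hf)]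
  refine integral_congr_ae (Filter.Eventually.of_forall fun x => ?_)
  exact integral_prod _ (Continuous.integrable_of_compactSpace (by fun_prop))

theorem average_sphereMeasure_prod {E : Type*} [NormedAddCommGroup E] [NormedSpace ℝ E] {d : ℕ}
    {f : UnitVector d × UnitVector d × UnitVector d → E} (hf : Continuous f) :
    ⨍ φ, f φ ∂((sphereMeasure d).prod ((sphereMeasure d).prod (sphereMeasure d))) =
      ∫ φ, f φ ∂(uniformSphereTriple d) := by
  rw [integral_uniformSphereTriple hf, average_prod (Continuous.integrable_of_compactSpace hf)]
  refine integral_congr_ae (Filter.Eventually.of_forall fun x => ?_)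
  exact average_prod (Continuous.integrable_of_compactSpace (by fun_prop))

theorem continuous_unitVector (d : ℕ) : Continuous fun φ : UnitVector d => φ.1.ofLp :=
  (PiLp.continuous_ofLp 2 _).comp continuous_subtype_val

open ComplexConjugate in
theorem sum_unitVector_mul_conj {d : ℕ} (φ : UnitVector d) :
    ∑ i, φ.1.ofLp i * conj (φ.1.ofLp i) = 1 := by
  rw [← EuclideanSpace.norm_sq_eq_sum_mul_conj φ.1, norm_eq_of_mem_sphere φ]
  simp

theorem isUnitarilyInvariant_uniformSphere (d : ℕ) :
    IsUnitarilyInvariant (uniformSphere d) fun φ => φ.1.ofLp := by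
  intro V hV f hf
  have h := (measurePreserving_sphereMap (unitaryIsometryEquiv V hV)).smul_measure
    ((sphereMeasure d Set.univ)⁻¹)
  have hc : Continuous fun φ : UnitVector d => f φ.1.ofLp := hf.comp (continuous_unitVector d)
  have h2 := integral_map (μ := uniformSphere d) (f := fun φ : UnitVector d => f φ.1.ofLp) h.measurable.aemeasurable
    hc.aestronglyMeasurable
  rw [show (uniformSphere d).map (sphereMap (unitaryIsometryEquiv V hV)) = uniformSphere d from
    h.map_eq] at h2
  exact h2.symm

open ComplexConjugate in
theorem fourthMoment_uniformSphere {d : ℕ} (hd : 1 ≤ d) (i j k l : Fin d) :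
    fourthMoment (uniformSphere d) (fun φ => φ.1.ofLp) i j k l =
      ((d : ℂ) * (d + 1))⁻¹ * ((if i = j then 1 else 0) * (if k = l then 1 else 0) +
        (if i = l then 1 else 0) * (if k = j then 1 else 0)) := by
  have := isProbabilityMeasure_uniformSphere hd
  rw [fourthMoment_eq_of_isUnitarilyInvariant (continuous_unitVector d)
    (isUnitarilyInvariant_uniformSphere d) sum_unitVector_mul_conj, Fintype.card_fin]

/-! ### Purities of bipartite tensors -/

section Purity

open ComplexConjugate

variable {A C K : Type*} [Fintype A] [Fintype C] [Fintype K]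

/-- The trace of the square of the reduction to the second subsystem of a bipartite vector. -/
noncomputable def purity (M : A → C → ℂ) : ℂ :=
  ∑ c, ∑ c', (∑ a, M a c * conj (M a c')) * ∑ a, M a c' * conj (M a c)

theorem purity_eq_sum (M : A → C → ℂ) :
    purity M = ∑ c, ∑ c', ∑ a, ∑ a', M a c * conj (M a c') * (M a' c' * conj (M a' c)) := by
  simp only [purity, Finset.sum_mul_sum]

theorem purity_eq_normSq (M : A → C → ℂ) :
    purity M = ((∑ c, ∑ c', Complex.normSq (∑ a, M a c * conj (M a c')) : ℝ) : ℂ) := by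
  push_cast
  refine Finset.sum_congr rfl fun c _ => Finset.sum_congr rfl fun c' _ => ?_
  rw [← Complex.mul_conj, map_sum]
  congr 1
  refine Finset.sum_congr rfl fun a _ => ?_
  rw [map_mul, Complex.conj_conj, mul_comm]

/-- The two reductions of a bipartite vector have equal purity; here this is only a reordering of
the quartic sum. -/
theorem purity_flip (M : A → C → ℂ) : purity (fun c a => M a c) = purity M := by
  rw [purity_eq_sum, purity_eq_sum, Finset.sum_congr rfl fun a _ => Finset.sum_comm,
    Finset.sum_comm]
  refine Finset.sum_congr rfl fun c _ => ?_
  rw [Finset.sum_congr rfl fun a _ => Finset.sum_comm, Finset.sum_comm]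
  refine Finset.sum_congr rfl fun c' _ => Finset.sum_congr rfl fun a _ =>
    Finset.sum_congr rfl fun a' _ => ?_
  ring

theorem ofReal_re_purity (M : A → C → ℂ) : ((purity M).re : ℂ) = purity M := by
  rw [purity_eq_normSq, Complex.ofReal_re]

/-- The squared norm of a bipartite tensor. -/
noncomputable def tensorNormSq (M : A → C → ℂ) : ℝ := ∑ a, ∑ c, Complex.normSq (M a c)

theorem tensorNormSq_flip (M : A → C → ℂ) : tensorNormSq (fun c a => M a c) = tensorNormSq M :=
  Finset.sum_comm

/-- Cauchy–Schwarz bounds the squared trace of the reduced matrix by its size times the sum of the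
squares of its diagonal entries; discarding the off-diagonal entries only lowers the purity. -/
theorem sq_tensorNormSq_le_right (M : A → C → ℂ) :
    tensorNormSq M ^ 2 ≤ Fintype.card C * (purity M).re := by
  have h1 : tensorNormSq M = ∑ c, ∑ a, Complex.normSq (M a c) := Finset.sum_comm
  rw [h1, purity_eq_normSq, Complex.ofReal_re]
  refine (sq_sum_le_card_mul_sum_sq).trans ?_
  rw [Finset.card_univ]
  refine mul_le_mul_of_nonneg_left (Finset.sum_le_sum fun c _ => ?_) (Nat.cast_nonneg _)
  refine le_trans (le_of_eq ?_) (Finset.single_le_sum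
    (f := fun c' => Complex.normSq (∑ a, M a c * conj (M a c')))
    (fun c' _ => Complex.normSq_nonneg _) (Finset.mem_univ c))
  have : ∑ a, M a c * conj (M a c) = ((∑ a, Complex.normSq (M a c) : ℝ) : ℂ) := by
    push_cast
    exact Finset.sum_congr rfl fun a _ => Complex.mul_conj _
  simp only [this, Complex.normSq_ofReal]
  ring

theorem sq_tensorNormSq_le_left (M : A → C → ℂ) :
    tensorNormSq M ^ 2 ≤ Fintype.card A * (purity M).re := by
  rw [← purity_flip, ← tensorNormSq_flip]
  exact sq_tensorNormSq_le_right _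

theorem purity_of_right_isometry [DecidableEq C] {M : A → C → ℂ} {κ : ℂ}
    (h : ∀ c c', ∑ a, M a c * conj (M a c') = if c = c' then κ else 0) :
    purity M = Fintype.card C * κ ^ 2 := by
  rw [purity]
  simp only [h]
  simp [pow_two]

theorem purity_of_left_isometry [DecidableEq A] {M : A → C → ℂ} {κ : ℂ}
    (h : ∀ a a', ∑ c, M a c * conj (M a' c) = if a = a' then κ else 0) :
    purity M = Fintype.card A * κ ^ 2 := by
  rw [← purity_flip]
  exact purity_of_right_isometry h

theorem continuous_purity {Ω : Type*} [TopologicalSpace Ω] {M : Ω → A → C → ℂ}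
    (h : ∀ a c, Continuous fun ω => M ω a c) : Continuous fun ω => purity (M ω) := by
  have h' : ∀ a c, Continuous fun ω => conj (M ω a c) := fun a c =>
    Complex.continuous_conj.comp (h a c)
  unfold purity
  fun_prop

/-! ### Mean purities from fourth moments -/

section Means

variable {Ω ι : Type*} [TopologicalSpace Ω] [CompactSpace Ω] [MeasurableSpace Ω]
  [OpensMeasurableSpace Ω] {μ : Measure Ω} [IsFiniteMeasure μ] {X : Ω → ι → ℂ}

theorem integral_quartic_sum {κ : Type*} [Fintype κ] (hX : Continuous X) (c : κ → ℂ)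
    (i j k l : κ → ι) :
    ∫ ω, ∑ s, c s * (X ω (i s) * conj (X ω (j s)) * (X ω (k s) * conj (X ω (l s)))) ∂μ =
      ∑ s, c s * fourthMoment μ X (i s) (j s) (k s) (l s) := by
  rw [integral_finsetSum]
  · simp only [integral_const_mul, fourthMoment]
  · exact fun s _ => (Continuous.integrable_of_compactSpace
      ((continuous_quartic _ _ _ _).comp hX)).const_mul _

theorem integral_purity (hX : Continuous X) (r : A → C → ι) :
    ∫ ω, purity (fun a c => X ω (r a c)) ∂μ =
      ∑ c, ∑ c', ∑ a, ∑ a', fourthMoment μ X (r a c) (r a c') (r a' c') (r a' c) := by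
  have h := integral_quartic_sum (μ := μ) hX (κ := C × C × A × A) (fun _ => 1)
    (fun s => r s.2.2.1 s.1) (fun s => r s.2.2.1 s.2.1) (fun s => r s.2.2.2 s.2.1)
    (fun s => r s.2.2.2 s.1)
  simp only [one_mul, Fintype.sum_prod_type] at h
  simp only [purity_eq_sum]
  exact h

/-- The mean purity of a random vector with isotropic fourth moments. -/
theorem integral_purity_of_fourthMoment [DecidableEq ι] (hX : Continuous X) {r : A → C → ι}
    (hr : ∀ a a' c c', r a c = r a' c' ↔ a = a' ∧ c = c') {β γ : ℂ}
    (h : ∀ i j k l, fourthMoment μ X i j k l =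
        β * ((if i = j then 1 else 0) * (if k = l then 1 else 0) +
          (if i = l then 1 else 0) * (if k = j then 1 else 0)) +
        γ * ((if i = k then 1 else 0) * (if j = l then 1 else 0))) :
    ∫ ω, purity (fun a c => X ω (r a c)) ∂μ =
      β * (Fintype.card A ^ 2 * Fintype.card C + Fintype.card A * Fintype.card C ^ 2) +
        γ * (Fintype.card A * Fintype.card C) := by
  classical
  rw [integral_purity hX]
  simp only [h, hr, true_and, and_true]
  -- The first pairing forces c = c', the second a = a', and the third both; hence the counts
  -- |A|²|C|, |A||C|² and |A||C|.
  have e : ∀ (c c' : C) (a a' : A),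
      β * ((if c = c' then 1 else 0) * (if c' = c then 1 else 0) +
        (if a = a' then 1 else 0) * (if a' = a then 1 else 0)) +
      γ * ((if a = a' ∧ c = c' then 1 else 0) * (if a = a' ∧ c' = c then 1 else 0)) =
      β * ((if c = c' then 1 else 0) + (if a = a' then 1 else 0)) +
      γ * ((if a = a' then 1 else 0) * (if c = c' then 1 else 0)) := by
    intro c c' a a'
    by_cases h1 : c = c' <;> by_cases h2 : a = a' <;>
      simp [h1, h2, eq_comm (a := c'), eq_comm (a := a')]
  simp only [e]
  simp [Finset.sum_add_distrib, ← Finset.mul_sum]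
  ring

end Means

theorem sum_comm_pairs {α β : Type*} [Fintype α] [Fintype β] (F : α → α → β → β → ℂ) :
    ∑ a, ∑ a', ∑ k, ∑ l, F a a' k l = ∑ k, ∑ l, ∑ a, ∑ a', F a a' k l := by
  simpa only [Fintype.sum_prod_type] using Finset.sum_comm (s := (Finset.univ : Finset (α × α)))
    (t := (Finset.univ : Finset (β × β))) (f := fun p q => F p.1 p.2 q.1 q.2)

/-- Of the two pairings of the four copies of φ, one contracts the index `k` in the same pattern as
the index of `A`, the other in the pattern of the index of `C`. So the averaged index becomes part
of one side or the other. -/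
theorem integral_purity_uniformSphere {d : ℕ} (hd : 1 ≤ d) (M : A → C → Fin d → ℂ) :
    ∫ φ, purity (fun a c => ∑ k, M a c k * φ.1.ofLp k) ∂(uniformSphere d) =
      ((d : ℂ) * (d + 1))⁻¹ * (purity (fun (p : A × Fin d) c => M p.1 c p.2) +
        purity (fun a (q : C × Fin d) => M a q.1 q.2)) := by
  have h := integral_quartic_sum (μ := uniformSphere d) (continuous_unitVector d)
    (κ := (C × C × A × A) × (Fin d × Fin d × Fin d × Fin d))
    (fun s => M s.1.2.2.1 s.1.1 s.2.1 * conj (M s.1.2.2.1 s.1.2.1 s.2.2.1) *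
      (M s.1.2.2.2 s.1.2.1 s.2.2.2.1 * conj (M s.1.2.2.2 s.1.1 s.2.2.2.2)))
    (fun s => s.2.1) (fun s => s.2.2.1) (fun s => s.2.2.2.1) (fun s => s.2.2.2.2)
  simp only [Fintype.sum_prod_type, fourthMoment_uniformSphere hd] at h
  have e : ∀ φ : UnitVector d, purity (fun a c => ∑ k, M a c k * φ.1.ofLp k) =
      ∑ c, ∑ c', ∑ a, ∑ a', ∑ k, ∑ l, ∑ m, ∑ n,
        M a c k * conj (M a c' l) * (M a' c' m * conj (M a' c n)) *
        (φ.1.ofLp k * conj (φ.1.ofLp l) * (φ.1.ofLp m * conj (φ.1.ofLp n))) := by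
    intro φ
    rw [purity_eq_sum]
    refine Finset.sum_congr rfl fun c _ => Finset.sum_congr rfl fun c' _ =>
      Finset.sum_congr rfl fun a _ => Finset.sum_congr rfl fun a' _ => ?_
    simp only [map_sum, map_mul, Finset.sum_mul_sum]
    refine Finset.sum_congr rfl fun k _ => ?_
    rw [Finset.sum_comm]
    refine Finset.sum_congr rfl fun l _ => Finset.sum_congr rfl fun m _ =>
      Finset.sum_congr rfl fun n _ => ?_
    ring
  simp only [e]
  rw [h, purity_eq_sum, purity_eq_sum]
  simp only [Fintype.sum_prod_type, mul_add, Finset.sum_add_distrib]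
  congr 1
  · simp only [Finset.mul_sum]
    refine Finset.sum_congr rfl fun c _ => Finset.sum_congr rfl fun c' _ =>
      Finset.sum_congr rfl fun a _ => ?_
    rw [Finset.sum_comm]
    refine Finset.sum_congr rfl fun k _ => Finset.sum_congr rfl fun a' _ => ?_
    simp
    refine Finset.sum_congr rfl fun l _ => ?_
    ring
  · simp only [Finset.mul_sum]
    refine Finset.sum_congr rfl fun c _ => ?_
    rw [Finset.sum_comm (s := (Finset.univ : Finset (Fin d)))]
    refine Finset.sum_congr rfl fun c' _ => ?_
    rw [← sum_comm_pairs]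
    refine Finset.sum_congr rfl fun a _ => Finset.sum_congr rfl fun a' _ =>
      Finset.sum_congr rfl fun k _ => ?_
    simp
    refine Finset.sum_congr rfl fun l _ => ?_
    ring

end Purity

/-! ### The entangling power as a sum of purities -/

section SplitPurity

open ComplexConjugate

variable {A C K : Type*} [Fintype A] [Fintype C] [Fintype K]

/-- The sum of the purities of the tensor `M` over all the ways of joining its three last indices
to one of its two first ones. -/
noncomputable def splitPurity (M : A → C → K → K → K → ℂ) : ℂ :=
  purity (fun (p : ((A × K) × K) × K) c => M p.1.1.1 c p.2 p.1.2 p.1.1.2) +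
  purity (fun (p : (A × K) × K) (q : C × K) => M p.1.1 q.1 q.2 p.2 p.1.2) +
  (purity (fun (p : (A × K) × K) (q : C × K) => M p.1.1 q.1 p.2 q.2 p.1.2) +
  purity (fun (p : A × K) (q : (C × K) × K) => M p.1 q.1.1 q.2 q.1.2 p.2)) +
  (purity (fun (p : (A × K) × K) (q : C × K) => M p.1.1 q.1 p.2 p.1.2 q.2) +
  purity (fun (p : A × K) (q : (C × K) × K) => M p.1 q.1.1 q.2 p.2 q.1.2) +
  (purity (fun (p : A × K) (q : (C × K) × K) => M p.1 q.1.1 p.2 q.2 q.1.2) +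
  purity (fun a (q : ((C × K) × K) × K) => M a q.1.1.1 q.2 q.1.2 q.1.1.2)))

theorem continuous_unitVector_apply {d : ℕ} (k : Fin d) :
    Continuous fun φ : UnitVector d => φ.1.ofLp k :=
  (continuous_apply k).comp (continuous_unitVector d)

theorem integrable_purity_contract {d : ℕ} (N : A → C → Fin d → ℂ) :
    Integrable (fun x : UnitVector d => purity fun a c => ∑ k, N a c k * x.1.ofLp k)
      (uniformSphere d) :=
  (continuous_purity fun _ _ => continuous_finsetSum _ fun k _ =>
    continuous_const.mul (continuous_unitVector_apply k)).integrable_of_compactSpace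

theorem integral_purity_contract_add {A' C' : Type*} [Fintype A'] [Fintype C'] {d : ℕ}
    (hd : 1 ≤ d) (N : A → C → Fin d → ℂ) (N' : A' → C' → Fin d → ℂ) :
    ∫ φ, (purity (fun a c => ∑ k, N a c k * φ.1.ofLp k) +
        purity (fun a c => ∑ k, N' a c k * φ.1.ofLp k)) ∂(uniformSphere d) =
      ((d : ℂ) * (d + 1))⁻¹ * ((purity (fun (p : A × Fin d) c => N p.1 c p.2) +
        purity (fun a (q : C × Fin d) => N a q.1 q.2)) +
        (purity (fun (p : A' × Fin d) c => N' p.1 c p.2) +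
        purity (fun a (q : C' × Fin d) => N' a q.1 q.2))) := by
  rw [integral_add (integrable_purity_contract N) (integrable_purity_contract N'),
    integral_purity_uniformSphere hd, integral_purity_uniformSphere hd, ← mul_add]

/-- Three applications of the single-sphere formula double the number of purities each time. The
innermost integral handles k₃, which is why k₃ is the first index attached in the nested products of
`splitPurity`. -/
theorem integral_purity_productState {d : ℕ} (hd : 1 ≤ d)
    (M : A → C → Fin d → Fin d → Fin d → ℂ) :
    ∫ x, ∫ y, ∫ z, purity (fun a c => ∑ k₃, (∑ k₂, (∑ k₁, M a c k₁ k₂ k₃ * x.1.ofLp k₁) *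
        y.1.ofLp k₂) * z.1.ofLp k₃) ∂(uniformSphere d) ∂(uniformSphere d) ∂(uniformSphere d) =
      ((d : ℂ) * (d + 1))⁻¹ ^ 3 * splitPurity M := by
  refine (congrArg (integral (uniformSphere d)) (funext fun x =>
    (congrArg (integral (uniformSphere d)) (funext fun y => integral_purity_uniformSphere hd
      (fun a c k₃ => ∑ k₂, (∑ k₁, M a c k₁ k₂ k₃ * x.1.ofLp k₁) * y.1.ofLp k₂))).trans
    ((integral_const_mul _ _).trans (congrArg (((d : ℂ) * (d + 1))⁻¹ * ·)
      (integral_purity_contract_add hd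
        (fun (p : A × Fin d) c k₂ => ∑ k₁, M p.1 c k₁ k₂ p.2 * x.1.ofLp k₁)
        (fun a (q : C × Fin d) k₂ => ∑ k₁, M a q.1 k₁ k₂ q.2 * x.1.ofLp k₁)))))).trans ?_
  have i₁ := integrable_purity_contract
    fun (p : (A × Fin d) × Fin d) (c : C) k₁ => M p.1.1 c k₁ p.2 p.1.2
  have i₂ := integrable_purity_contract
    fun (p : A × Fin d) (q : C × Fin d) k₁ => M p.1 q.1 k₁ q.2 p.2
  have i₃ := integrable_purity_contract
    fun (p : A × Fin d) (q : C × Fin d) k₁ => M p.1 q.1 k₁ p.2 q.2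
  have i₄ := integrable_purity_contract
    fun (a : A) (q : (C × Fin d) × Fin d) k₁ => M a q.1.1 k₁ q.2 q.1.2
  have e₁ := integral_purity_contract_add hd
    (fun (p : (A × Fin d) × Fin d) (c : C) k₁ => M p.1.1 c k₁ p.2 p.1.2)
    (fun (p : A × Fin d) (q : C × Fin d) k₁ => M p.1 q.1 k₁ q.2 p.2)
  have e₂ := integral_purity_contract_add hd
    (fun (p : A × Fin d) (q : C × Fin d) k₁ => M p.1 q.1 k₁ p.2 q.2)
    (fun (a : A) (q : (C × Fin d) × Fin d) k₁ => M a q.1.1 k₁ q.2 q.1.2)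
  refine (integral_const_mul _ _).trans ((congrArg (((d : ℂ) * (d + 1))⁻¹ * ·)
    ((integral_const_mul _ _).trans (congrArg (((d : ℂ) * (d + 1))⁻¹ * ·)
      ((integral_add (i₁.add i₂) (i₃.add i₄)).trans (congrArg₂ (· + ·) e₁ e₂))))).trans ?_)
  rw [splitPurity]
  ring

theorem tensorNormSq_left (N : A → C → K → ℂ) :
    tensorNormSq (fun (p : A × K) c => N p.1 c p.2) = ∑ k, tensorNormSq fun a c => N a c k := by
  simp only [tensorNormSq, Fintype.sum_prod_type]
  exact Finset.sum_comm

theorem tensorNormSq_right (N : A → C → K → ℂ) :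
    tensorNormSq (fun a (q : C × K) => N a q.1 q.2) = ∑ k, tensorNormSq fun a c => N a c k := by
  simp only [tensorNormSq, Fintype.sum_prod_type]
  rw [Finset.sum_comm (s := (Finset.univ : Finset K))]
  exact Finset.sum_congr rfl fun a _ => Finset.sum_comm

/-- A lower bound of a sum of purities from the Cauchy–Schwarz inequality. -/
theorem le_re_splitPurity [Nonempty A] [Nonempty C] [Nonempty K] (M : A → C → K → K → K → ℂ)
    {S : ℝ} (hS : ∑ k₁, ∑ k₂, ∑ k₃, tensorNormSq (fun a c => M a c k₁ k₂ k₃) = S) :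
    S ^ 2 * (1 / Fintype.card C + 3 / (Fintype.card C * Fintype.card K) +
      3 / (Fintype.card A * Fintype.card K) + 1 / Fintype.card A) ≤ (splitPurity M).re := by
  have hA : (0 : ℝ) < Fintype.card A := by exact_mod_cast Fintype.card_pos
  have hC : (0 : ℝ) < Fintype.card C := by exact_mod_cast Fintype.card_pos
  have hK : (0 : ℝ) < Fintype.card K := by exact_mod_cast Fintype.card_pos
  -- In the application |A| = d² and |C| = |K| = d, so the side chosen below always has the smaller
  -- dimension: the `C` side when it receives at most one input, the `A` side otherwise (a tie at d³
  -- when it receives two).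
  have b1 := sq_tensorNormSq_le_right
    (fun (p : ((A × K) × K) × K) c => M p.1.1.1 c p.2 p.1.2 p.1.1.2)
  have b2 := sq_tensorNormSq_le_right
    (fun (p : (A × K) × K) (q : C × K) => M p.1.1 q.1 q.2 p.2 p.1.2)
  have b3 := sq_tensorNormSq_le_right
    (fun (p : (A × K) × K) (q : C × K) => M p.1.1 q.1 p.2 q.2 p.1.2)
  have b4 := sq_tensorNormSq_le_left
    (fun (p : A × K) (q : (C × K) × K) => M p.1 q.1.1 q.2 q.1.2 p.2)
  have b5 := sq_tensorNormSq_le_right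
    (fun (p : (A × K) × K) (q : C × K) => M p.1.1 q.1 p.2 p.1.2 q.2)
  have b6 := sq_tensorNormSq_le_left
    (fun (p : A × K) (q : (C × K) × K) => M p.1 q.1.1 q.2 p.2 q.1.2)
  have b7 := sq_tensorNormSq_le_left
    (fun (p : A × K) (q : (C × K) × K) => M p.1 q.1.1 p.2 q.2 q.1.2)
  have b8 := sq_tensorNormSq_le_left
    (fun a (q : ((C × K) × K) × K) => M a q.1.1.1 q.2 q.1.2 q.1.1.2)
  rw [(tensorNormSq_left fun (p : (A × K) × K) c k₁ => M p.1.1 c k₁ p.2 p.1.2).trans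
    (Finset.sum_congr rfl fun k₁ _ => (tensorNormSq_left fun (p : A × K) c k₂ =>
      M p.1 c k₁ k₂ p.2).trans (Finset.sum_congr rfl fun k₂ _ =>
        tensorNormSq_left fun a c k₃ => M a c k₁ k₂ k₃)), hS] at b1
  rw [(tensorNormSq_right fun (p : (A × K) × K) c k₁ => M p.1.1 c k₁ p.2 p.1.2).trans
    (Finset.sum_congr rfl fun k₁ _ => (tensorNormSq_left fun (p : A × K) c k₂ =>
      M p.1 c k₁ k₂ p.2).trans (Finset.sum_congr rfl fun k₂ _ =>
        tensorNormSq_left fun a c k₃ => M a c k₁ k₂ k₃)), hS] at b2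
  rw [(tensorNormSq_left fun (p : A × K) (q : C × K) k₁ => M p.1 q.1 k₁ q.2 p.2).trans
    (Finset.sum_congr rfl fun k₁ _ => (tensorNormSq_right fun (p : A × K) c k₂ =>
      M p.1 c k₁ k₂ p.2).trans (Finset.sum_congr rfl fun k₂ _ =>
        tensorNormSq_left fun a c k₃ => M a c k₁ k₂ k₃)), hS] at b3
  rw [(tensorNormSq_right fun (p : A × K) (q : C × K) k₁ => M p.1 q.1 k₁ q.2 p.2).trans
    (Finset.sum_congr rfl fun k₁ _ => (tensorNormSq_right fun (p : A × K) c k₂ =>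
      M p.1 c k₁ k₂ p.2).trans (Finset.sum_congr rfl fun k₂ _ =>
        tensorNormSq_left fun a c k₃ => M a c k₁ k₂ k₃)), hS] at b4
  rw [(tensorNormSq_left fun (p : A × K) (q : C × K) k₁ => M p.1 q.1 k₁ p.2 q.2).trans
    (Finset.sum_congr rfl fun k₁ _ => (tensorNormSq_left fun a (q : C × K) k₂ =>
      M a q.1 k₁ k₂ q.2).trans (Finset.sum_congr rfl fun k₂ _ =>
        tensorNormSq_right fun a c k₃ => M a c k₁ k₂ k₃)), hS] at b5
  rw [(tensorNormSq_right fun (p : A × K) (q : C × K) k₁ => M p.1 q.1 k₁ p.2 q.2).trans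
    (Finset.sum_congr rfl fun k₁ _ => (tensorNormSq_left fun a (q : C × K) k₂ =>
      M a q.1 k₁ k₂ q.2).trans (Finset.sum_congr rfl fun k₂ _ =>
        tensorNormSq_right fun a c k₃ => M a c k₁ k₂ k₃)), hS] at b6
  rw [(tensorNormSq_left fun a (q : (C × K) × K) k₁ => M a q.1.1 k₁ q.2 q.1.2).trans
    (Finset.sum_congr rfl fun k₁ _ => (tensorNormSq_right fun a (q : C × K) k₂ =>
      M a q.1 k₁ k₂ q.2).trans (Finset.sum_congr rfl fun k₂ _ =>
        tensorNormSq_right fun a c k₃ => M a c k₁ k₂ k₃)), hS] at b7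
  rw [(tensorNormSq_right fun a (q : (C × K) × K) k₁ => M a q.1.1 k₁ q.2 q.1.2).trans
    (Finset.sum_congr rfl fun k₁ _ => (tensorNormSq_right fun a (q : C × K) k₂ =>
      M a q.1 k₁ k₂ q.2).trans (Finset.sum_congr rfl fun k₂ _ =>
        tensorNormSq_right fun a c k₃ => M a c k₁ k₂ k₃)), hS] at b8
  simp only [Fintype.card_prod, Nat.cast_mul, ← div_le_iff₀' hC, ← div_le_iff₀' hA,
    ← div_le_iff₀' (mul_pos hC hK), ← div_le_iff₀' (mul_pos hA hK)] at b1 b2 b3 b4 b5 b6 b7 b8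
  simp only [splitPurity, Complex.add_re]
  calc _ = S ^ 2 / Fintype.card C + 3 * (S ^ 2 / (Fintype.card C * Fintype.card K)) +
      3 * (S ^ 2 / (Fintype.card A * Fintype.card K)) + S ^ 2 / Fintype.card A := by ring
    _ ≤ _ := by linarith

theorem sum_reverse (F : K → K → K → ℂ) :
    ∑ k₃, ∑ k₂, ∑ k₁, F k₁ k₂ k₃ = ∑ k₁, ∑ k₂, ∑ k₃, F k₁ k₂ k₃ := by
  rw [Finset.sum_congr rfl fun k₃ _ => Finset.sum_comm, Finset.sum_comm]
  exact Finset.sum_congr rfl fun k₁ _ => Finset.sum_comm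

/-- The sum of purities of a tensor all of whose balanced reductions are maximally mixed. -/
theorem splitPurity_eq [DecidableEq A] [DecidableEq C] [DecidableEq K]
    {M : A → C → K → K → K → ℂ}
    (h₀ : ∀ a c a' c', ∑ k₁, ∑ k₂, ∑ k₃, M a c k₁ k₂ k₃ * conj (M a' c' k₁ k₂ k₃) =
      if a = a' ∧ c = c' then 1 else 0)
    (h₁₂ : ∀ c k₁ k₂ c' k₁' k₂', ∑ a, ∑ k₃, M a c k₁ k₂ k₃ * conj (M a c' k₁' k₂' k₃) =
      if c = c' ∧ k₁ = k₁' ∧ k₂ = k₂' then 1 else 0)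
    (h₁₃ : ∀ c k₁ k₃ c' k₁' k₃', ∑ a, ∑ k₂, M a c k₁ k₂ k₃ * conj (M a c' k₁' k₂ k₃') =
      if c = c' ∧ k₁ = k₁' ∧ k₃ = k₃' then 1 else 0)
    (h₂₃ : ∀ c k₂ k₃ c' k₂' k₃', ∑ a, ∑ k₁, M a c k₁ k₂ k₃ * conj (M a c' k₁ k₂' k₃') =
      if c = c' ∧ k₂ = k₂' ∧ k₃ = k₃' then 1 else 0) :
    splitPurity M = Fintype.card C * Fintype.card A ^ 2 +
      3 * (Fintype.card C * Fintype.card K * Fintype.card K ^ 2) +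
      3 * (Fintype.card C * Fintype.card K * Fintype.card K) +
      Fintype.card A * Fintype.card C ^ 2 := by
  -- Balanced reductions are identities (κ = 1). For a smaller reduction, κ counts the values of the
  -- additional index that is summed out.
  rw [splitPurity, purity_of_right_isometry (κ := Fintype.card A),
    purity_of_right_isometry (κ := Fintype.card K),
    purity_of_right_isometry (κ := Fintype.card K),
    purity_of_right_isometry (κ := 1),
    purity_of_right_isometry (κ := Fintype.card K),
    purity_of_right_isometry (κ := 1),
    purity_of_right_isometry (κ := 1),
    purity_of_left_isometry (κ := Fintype.card C)]
  · simp only [Fintype.card_prod]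
    push_cast
    ring
  · rintro a a'
    simp only [Fintype.sum_prod_type]
    rw [Finset.sum_congr rfl fun c _ => (sum_reverse _).trans (h₀ a c a' c)]
    by_cases h : a = a' <;> simp [h]
  · rintro ⟨⟨c, k₃⟩, k₂⟩ ⟨⟨c', k₃'⟩, k₂'⟩
    simp only [Fintype.sum_prod_type]
    rw [h₂₃]
    exact if_congr (by simp only [Prod.mk.injEq]; tauto) rfl rfl
  · rintro ⟨⟨c, k₃⟩, k₁⟩ ⟨⟨c', k₃'⟩, k₁'⟩
    simp only [Fintype.sum_prod_type]
    rw [h₁₃]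
    exact if_congr (by simp only [Prod.mk.injEq]; tauto) rfl rfl
  · rintro ⟨c, k₃⟩ ⟨c', k₃'⟩
    simp only [Fintype.sum_prod_type]
    -- A reduction to `C` and one input is obtained from a balanced one by tracing out a further
    -- input.
    rw [Finset.sum_congr rfl fun a _ => Finset.sum_comm, Finset.sum_comm,
      Finset.sum_congr rfl fun k₁ _ => h₁₃ c k₁ k₃ c' k₁ k₃']
    simp [Finset.sum_ite_irrel]
  · rintro ⟨⟨c, k₂⟩, k₁⟩ ⟨⟨c', k₂'⟩, k₁'⟩
    simp only [Fintype.sum_prod_type]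
    rw [h₁₂]
    exact if_congr (by simp only [Prod.mk.injEq]; tauto) rfl rfl
  · rintro ⟨c, k₂⟩ ⟨c', k₂'⟩
    simp only [Fintype.sum_prod_type]
    rw [Finset.sum_congr rfl fun a _ => Finset.sum_comm, Finset.sum_comm,
      Finset.sum_congr rfl fun k₁ _ => h₁₂ c k₁ k₂ c' k₁ k₂']
    simp [Finset.sum_ite_irrel]
  · rintro ⟨c, k₁⟩ ⟨c', k₁'⟩
    simp only [Fintype.sum_prod_type]
    rw [Finset.sum_congr rfl fun a _ => Finset.sum_comm, Finset.sum_comm,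
      Finset.sum_congr rfl fun k₂ _ => h₁₂ c k₁ k₂ c' k₁' k₂]
    simp [Finset.sum_ite_irrel]
  · rintro c c'
    simp only [Fintype.sum_prod_type]
    rw [Finset.sum_congr rfl fun a _ => (sum_reverse _).trans (h₀ a c a c')]
    by_cases h : c = c' <;> simp [h]

end SplitPurity

/-! ### The one-tangle and the entangling power -/

/-- The embedding of a bipartite index, the second component being the index of the subsystem
`s`. -/
def sliceIndex {d : ℕ} : Fin 3 → Fin d × Fin d → Fin d → TripartiteIndex d d d :=
  ![fun p j => (j, p.1, p.2), fun p j => (p.1, j, p.2), fun p j => (p.1, p.2, j)]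

theorem sliceIndex_eq_iff {d : ℕ} (s : Fin 3) (a a' : Fin d × Fin d) (c c' : Fin d) :
    sliceIndex s a c = sliceIndex s a' c' ↔ a = a' ∧ c = c' := by
  fin_cases s <;> simp [sliceIndex, Prod.ext_iff] <;> tauto

theorem oneTangle_eq {d : ℕ} (ψ : TripartiteIndex d d d → ℂ) :
    oneTangle ψ = 2 / 3 * ∑ s, (1 - (purity fun p j => ψ (sliceIndex s p j)).re) := by
  have h1 : Matrix.trace (partialTrace12 (pureStateMatrix ψ) * partialTrace12 (pureStateMatrix ψ)) =
      purity fun p j => ψ (sliceIndex 2 p j) := by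
    simp [Matrix.trace, Matrix.mul_apply, partialTrace12, pureStateMatrix, Matrix.vecMulVec_apply,
      purity, Fintype.sum_prod_type, sliceIndex]
  have h2 : Matrix.trace (partialTrace13 (pureStateMatrix ψ) * partialTrace13 (pureStateMatrix ψ)) =
      purity fun p j => ψ (sliceIndex 1 p j) := by
    simp [Matrix.trace, Matrix.mul_apply, partialTrace13, pureStateMatrix, Matrix.vecMulVec_apply,
      purity, Fintype.sum_prod_type, sliceIndex]
  have h3 : Matrix.trace (partialTrace23 (pureStateMatrix ψ) * partialTrace23 (pureStateMatrix ψ)) =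
      purity fun p j => ψ (sliceIndex 0 p j) := by
    simp [Matrix.trace, Matrix.mul_apply, partialTrace23, pureStateMatrix, Matrix.vecMulVec_apply,
      purity, Fintype.sum_prod_type, sliceIndex]
  rw [oneTangle, concurrenceOfReduced, concurrenceOfReduced, concurrenceOfReduced, h1, h2, h3,
    Fin.sum_univ_three]
  ring

theorem continuous_oneTangle {d : ℕ} : Continuous (oneTangle (d₁ := d) (d₂ := d) (d₃ := d)) := by
  rw [funext oneTangle_eq]
  have h : ∀ s, Continuous fun ψ : TripartiteIndex d d d → ℂ =>
      (purity fun p j => ψ (sliceIndex s p j)).re := fun s =>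
    Complex.continuous_re.comp (continuous_purity fun p j => continuous_apply _)
  fun_prop

/-- The mean one-tangle of a random vector. -/
theorem integral_oneTangle {Ω : Type*} [TopologicalSpace Ω] [CompactSpace Ω]
    [MeasurableSpace Ω] [OpensMeasurableSpace Ω] {μ : Measure Ω} [IsProbabilityMeasure μ] {d : ℕ}
    {X : Ω → TripartiteIndex d d d → ℂ} (hX : Continuous X) :
    ((∫ ω, oneTangle (X ω) ∂μ : ℝ) : ℂ) =
      2 / 3 * ∑ s, (1 - ∫ ω, purity (fun p j => X ω (sliceIndex s p j)) ∂μ) := by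
  have hi : ∀ s, Integrable (fun ω => purity (fun p j => X ω (sliceIndex s p j))) μ := fun s =>
    (continuous_purity fun p j => (continuous_apply _).comp hX).integrable_of_compactSpace
  have hi' : ∀ s, Integrable (fun ω => 1 - purity (fun p j => X ω (sliceIndex s p j))) μ :=
    fun s => (integrable_const _).sub (hi s)
  rw [← integral_complex_ofReal]
  simp only [oneTangle_eq, Complex.ofReal_mul, Complex.ofReal_sum, Complex.ofReal_sub,
    ofReal_re_purity, Complex.ofReal_one, Complex.ofReal_div, Complex.ofReal_ofNat]
  rw [integral_const_mul, integral_finsetSum _ fun s _ => hi' s]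
  congr 1
  refine Finset.sum_congr rfl fun s _ => ?_
  rw [integral_sub (integrable_const _) (hi s)]
  simp

theorem continuous_productState {d : ℕ} :
    Continuous (productState (d₁ := d) (d₂ := d) (d₃ := d)) := by
  refine continuous_pi fun j => ?_
  exact (((continuous_unitVector_apply j.1).comp continuous_fst).mul
    ((continuous_unitVector_apply j.2.1).comp (continuous_fst.comp continuous_snd))).mul
    ((continuous_unitVector_apply j.2.2).comp (continuous_snd.comp continuous_snd))

theorem mulVec_productState {d : ℕ} (U : Matrix (TripartiteIndex d d d) (TripartiteIndex d d d) ℂ)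
    (φ : UnitVector d × UnitVector d × UnitVector d) (i : TripartiteIndex d d d) :
    (U *ᵥ productState φ) i = ∑ k₃, (∑ k₂, (∑ k₁, U i (k₁, k₂, k₃) * φ.1.1.ofLp k₁) *
      φ.2.1.1.ofLp k₂) * φ.2.2.1.ofLp k₃ := by
  simp only [Matrix.mulVec, dotProduct, Fintype.sum_prod_type, productState, Finset.sum_mul]
  rw [sum_reverse]
  refine Finset.sum_congr rfl fun k₁ _ => Finset.sum_congr rfl fun k₂ _ =>
    Finset.sum_congr rfl fun k₃ _ => ?_
  ring

theorem entanglingPower_eq_integral {d : ℕ}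
    (U : Matrix (TripartiteIndex d d d) (TripartiteIndex d d d) ℂ) :
    entanglingPower U = ∫ φ, oneTangle (U *ᵥ productState φ) ∂(uniformSphereTriple d) :=
  average_sphereMeasure_prod
    (continuous_oneTangle.comp (continuous_const.matrix_mulVec continuous_productState))

/-- The entangling power as a combination of purities of the matrix, viewed as a tensor. -/
theorem entanglingPower_eq {d : ℕ} (hd : 1 ≤ d)
    (U : Matrix (TripartiteIndex d d d) (TripartiteIndex d d d) ℂ) :
    entanglingPower U = 2 / 3 * ∑ s, (1 - ((d : ℝ) * (d + 1))⁻¹ ^ 3 *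
      (splitPurity fun p j k₁ k₂ k₃ => U (sliceIndex s p j) (k₁, k₂, k₃)).re) := by
  have := isProbabilityMeasure_uniformSphereTriple hd
  have hX : Continuous fun φ : UnitVector d × UnitVector d × UnitVector d =>
      U *ᵥ productState φ := continuous_const.matrix_mulVec continuous_productState
  have h := integral_oneTangle (μ := uniformSphereTriple d) hX
  have e : ∀ s, ∫ φ, purity (fun p j => (U *ᵥ productState φ) (sliceIndex s p j))
      ∂(uniformSphereTriple d) = ((d : ℂ) * (d + 1))⁻¹ ^ 3 *
        splitPurity fun p j k₁ k₂ k₃ => U (sliceIndex s p j) (k₁, k₂, k₃) := by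
    intro s
    have hc : Continuous fun φ : UnitVector d × UnitVector d × UnitVector d =>
        purity fun p j => (U *ᵥ productState φ) (sliceIndex s p j) :=
      continuous_purity fun p j => (continuous_apply _).comp hX
    rw [integral_uniformSphereTriple hc, ← integral_purity_productState hd]
    simp only [mulVec_productState]
  simp only [e] at h
  rw [← entanglingPower_eq_integral] at h
  have h' := congrArg Complex.re h
  rw [Complex.ofReal_re] at h'
  rw [h']
  have c1 : ((2 / 3 : ℂ)) = ((2 / 3 : ℝ) : ℂ) := by push_cast; rfl
  have c2 : ((d : ℂ) * (d + 1))⁻¹ ^ 3 = ((((d : ℝ) * (d + 1))⁻¹ ^ 3 : ℝ) : ℂ) := by push_cast; rfl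
  rw [c1, c2, Complex.re_ofReal_mul, Complex.re_sum]
  simp only [Complex.sub_re, Complex.one_re, Complex.re_ofReal_mul]

theorem sum_mul_conj_row {d : ℕ} {U : Matrix (TripartiteIndex d d d) (TripartiteIndex d d d) ℂ}
    (hU : U ∈ Matrix.unitaryGroup (TripartiteIndex d d d) ℂ) (i j : TripartiteIndex d d d) :
    ∑ k₁, ∑ k₂, ∑ k₃, U i (k₁, k₂, k₃) * (starRingEnd ℂ) (U j (k₁, k₂, k₃)) =
      if i = j then 1 else 0 := by
  have := congrArg (fun M : Matrix _ _ ℂ => M i j) (Matrix.mem_unitaryGroup_iff.mp hU)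
  simpa [Matrix.mul_apply, Fintype.sum_prod_type, Matrix.one_apply] using this

/-- The rows of a unitary are unit vectors, so the tensor has squared norm d³. The Cauchy–Schwarz
bound on the eight purities is then d³(d + 1)(d + 3) for each output subsystem. -/
theorem entanglingPower_le {d : ℕ} (hd : 1 ≤ d)
    {U : Matrix (TripartiteIndex d d d) (TripartiteIndex d d d) ℂ}
    (hU : U ∈ Matrix.unitaryGroup (TripartiteIndex d d d) ℂ) :
    entanglingPower U ≤ 2 * (((d : ℝ) ^ 2 + (d : ℝ) - 2) / (1 + (d : ℝ)) ^ 2) := by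
  have : Nonempty (Fin d) := ⟨⟨0, hd⟩⟩
  have hd' : (0 : ℝ) < d := by exact_mod_cast hd
  have hS : ∀ s : Fin 3, ∑ k₁, ∑ k₂, ∑ k₃,
      tensorNormSq (fun (p : Fin d × Fin d) j => U (sliceIndex s p j) (k₁, k₂, k₃)) =
        (d : ℝ) ^ 3 := by
    intro s
    have e : ∑ k₁, ∑ k₂, ∑ k₃,
      tensorNormSq (fun (p : Fin d × Fin d) j => U (sliceIndex s p j) (k₁, k₂, k₃)) =
      ∑ p : Fin d × Fin d, ∑ j, ∑ k₁, ∑ k₂, ∑ k₃,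
        Complex.normSq (U (sliceIndex s p j) (k₁, k₂, k₃)) := by
      simp only [tensorNormSq]
      have := Finset.sum_comm (s := (Finset.univ : Finset (Fin d × Fin d × Fin d)))
        (t := (Finset.univ : Finset ((Fin d × Fin d) × Fin d)))
        (f := fun k p => Complex.normSq (U (sliceIndex s p.1 p.2) k))
      simpa only [Fintype.sum_prod_type] using this
    rw [e]
    have e2 : ∀ i, ∑ k₁, ∑ k₂, ∑ k₃, Complex.normSq (U i (k₁, k₂, k₃)) = 1 := by
      intro i
      have := sum_mul_conj_row hU i i
      simp only [Complex.mul_conj, if_true] at this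
      exact_mod_cast this
    simp only [e2]
    simp
    ring
  have hs : ∀ s : Fin 3, 1 - ((d : ℝ) * (d + 1))⁻¹ ^ 3 *
      (splitPurity fun p j k₁ k₂ k₃ => U (sliceIndex s p j) (k₁, k₂, k₃)).re ≤
      ((d : ℝ) ^ 2 + d - 2) / (1 + d) ^ 2 := by
    intro s
    have := mul_le_mul_of_nonneg_left (le_re_splitPurity _ (hS s))
      (show 0 ≤ ((d : ℝ) * (d + 1))⁻¹ ^ 3 by positivity)
    simp only [Fintype.card_prod, Fintype.card_fin, Nat.cast_mul] at this
    refine (sub_le_sub_left this 1).trans (le_of_eq ?_)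
    field_simp
    ring
  rw [entanglingPower_eq hd, Fin.sum_univ_three]
  linarith [hs 0, hs 1, hs 2]

/-! ### Means over compact groups -/

section HaarMean

open ComplexConjugate

variable {G : Type*} [Group G] [TopologicalSpace G] [IsTopologicalGroup G] [CompactSpace G]

theorem haarMean_eq [m : MeasurableSpace G] [hm : BorelSpace G] (f : G → ℝ) :
    haarMean G f = ∫ g, f g ∂(Measure.haarMeasure (⊤ : TopologicalSpace.PositiveCompacts G)) := by
  obtain rfl := hm.measurable_eq
  rfl

instance isProbabilityMeasure_haarMeasure_top [MeasurableSpace G] [BorelSpace G] :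
    IsProbabilityMeasure (Measure.haarMeasure (⊤ : TopologicalSpace.PositiveCompacts G)) :=
  ⟨by simpa using Measure.haarMeasure_self (K₀ := (⊤ : TopologicalSpace.PositiveCompacts G))⟩

theorem haarMean_entanglingPower {d : ℕ}
    {ρ : G → Matrix (TripartiteIndex d d d) (TripartiteIndex d d d) ℂ} (hρ : Continuous ρ) :
    haarMean G (fun g => entanglingPower (ρ g)) =
      ∫ φ, haarMean G (fun g => oneTangle (ρ g *ᵥ productState φ)) ∂(uniformSphereTriple d) := by
  let _ : MeasurableSpace G := borel G
  have : BorelSpace G := ⟨rfl⟩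
  simp only [haarMean_eq, entanglingPower_eq_integral]
  refine integral_integral_swap_of_hasCompactSupport ?_ (HasCompactSupport.of_compactSpace _)
  exact continuous_oneTangle.comp
    ((hρ.comp continuous_fst).matrix_mulVec (continuous_productState.comp continuous_snd))

theorem haarMean_const (c : ℝ) : haarMean G (fun _ => c) = c := by
  let _ : MeasurableSpace G := borel G
  have : BorelSpace G := ⟨rfl⟩
  rw [haarMean_eq]
  simp

end HaarMean

/-! ### Mean over the unitary group -/

section UnitaryMean

open ComplexConjugate

theorem sum_productState_mul_conj {d : ℕ} (φ : UnitVector d × UnitVector d × UnitVector d) :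
    ∑ i, productState φ i * conj (productState φ i) = 1 := by
  simp only [productState, Fintype.sum_prod_type, map_mul]
  have e : ∀ i j k, φ.1.1.ofLp i * φ.2.1.1.ofLp j * φ.2.2.1.ofLp k *
      (conj (φ.1.1.ofLp i) * conj (φ.2.1.1.ofLp j) * conj (φ.2.2.1.ofLp k)) =
      (φ.1.1.ofLp i * conj (φ.1.1.ofLp i)) * ((φ.2.1.1.ofLp j * conj (φ.2.1.1.ofLp j)) *
        (φ.2.2.1.ofLp k * conj (φ.2.2.1.ofLp k))) := fun i j k => by ring
  simp only [e, ← Finset.mul_sum, sum_unitVector_mul_conj, mul_one]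

theorem continuous_mulVec_coe {ι : Type*} [Fintype ι] [DecidableEq ι] (ψ : ι → ℂ) :
    Continuous fun U : Matrix.unitaryGroup ι ℂ => (U : Matrix ι ι ℂ) *ᵥ ψ :=
  continuous_subtype_val.matrix_mulVec continuous_const

theorem isUnitarilyInvariant_haar {ι : Type*} [Fintype ι] [DecidableEq ι]
    [MeasurableSpace (Matrix.unitaryGroup ι ℂ)] [BorelSpace (Matrix.unitaryGroup ι ℂ)]
    (ψ : ι → ℂ) :
    IsUnitarilyInvariant (Measure.haarMeasure
      (⊤ : TopologicalSpace.PositiveCompacts (Matrix.unitaryGroup ι ℂ)))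
      (fun U => (U : Matrix ι ι ℂ) *ᵥ ψ) := by
  intro V hV f _
  have := integral_mul_left_eq_self (μ := Measure.haarMeasure
      (⊤ : TopologicalSpace.PositiveCompacts (Matrix.unitaryGroup ι ℂ)))
    (fun U : Matrix.unitaryGroup ι ℂ => f ((U : Matrix ι ι ℂ) *ᵥ ψ)) ⟨V, hV⟩
  simp only [Matrix.mulVec_mulVec]
  exact this

theorem haarMean_unitaryGroup_oneTangle {d : ℕ} (hd : 1 ≤ d) {ψ : TripartiteIndex d d d → ℂ}
    (hψ : ∑ i, ψ i * conj (ψ i) = 1) :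
    haarMean (Matrix.unitaryGroup (TripartiteIndex d d d) ℂ)
      (fun U => oneTangle ((U : Matrix (TripartiteIndex d d d) (TripartiteIndex d d d) ℂ) *ᵥ ψ)) =
        2 * (((d : ℝ) - 1) ^ 2 / ((d : ℝ) ^ 2 - (d : ℝ) + 1)) := by
  let _ : MeasurableSpace (Matrix.unitaryGroup (TripartiteIndex d d d) ℂ) := borel _
  have : BorelSpace (Matrix.unitaryGroup (TripartiteIndex d d d) ℂ) := ⟨rfl⟩
  have hX := continuous_mulVec_coe ψ
  have hm := fourthMoment_eq_of_isUnitarilyInvariant hX (isUnitarilyInvariant_haar ψ)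
    (fun U => (sum_mulVec_mul_conj U.2 ψ).trans hψ)
  have hp : ∀ s : Fin 3, _ := fun s => integral_purity_of_fourthMoment hX
    -- The unitary moments are put in the three-pairing form with γ = 0.
    (r := sliceIndex s) (sliceIndex_eq_iff s) (fun i j k l => (hm i j k l).trans
      ((add_zero _).symm.trans (congrArg _ (zero_mul _).symm)))
  have h := integral_oneTangle (μ := Measure.haarMeasure
    (⊤ : TopologicalSpace.PositiveCompacts (Matrix.unitaryGroup (TripartiteIndex d d d) ℂ))) hX
  simp only [hp] at h
  rw [haarMean_eq]
  apply Complex.ofReal_injective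
  rw [h]
  have hd' : (0 : ℝ) < d := by exact_mod_cast hd
  have h1 : (d : ℂ) ≠ 0 := by exact_mod_cast hd'.ne'
  have h2 : (d : ℂ) + 1 ≠ 0 := by exact_mod_cast (by omega : d + 1 ≠ 0)
  -- Making this factor opaque lets d³ + 1 = (d + 1)D cancel against the numerator d(d + 1).
  obtain ⟨D, hD⟩ : ∃ D : ℂ, (d : ℂ) ^ 2 - d + 1 = D := ⟨_, rfl⟩
  have h3 : D ≠ 0 := by
    have : (d : ℝ) ^ 2 - d + 1 ≠ 0 := by nlinarith
    rw [← hD]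
    exact_mod_cast this
  have h4 : (d : ℂ) * (d * d) + 1 = (d + 1) * D := by
    rw [← hD]
    ring
  simp only [Fintype.card_prod, Fintype.card_fin, Finset.sum_const, Finset.card_univ,
    nsmul_eq_mul]
  push_cast
  rw [h4, hD]
  field_simp
  rw [← hD]
  ring

end UnitaryMean

/-! ### Mean over the orthogonal group -/

section OrthogonalMean

open ComplexConjugate

theorem continuous_map_mulVec_coe {ι : Type*} [Fintype ι] [DecidableEq ι] (ψ : ι → ℂ) :
    Continuous fun O : Matrix.orthogonalGroup ι ℝ =>
      (O : Matrix ι ι ℝ).map (fun x : ℝ => (x : ℂ)) *ᵥ ψ :=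
  (continuous_subtype_val.matrix_map Complex.continuous_ofReal).matrix_mulVec continuous_const

theorem isOrthogonallyInvariant_haar {ι : Type*} [Fintype ι] [DecidableEq ι]
    [MeasurableSpace (Matrix.orthogonalGroup ι ℝ)] [BorelSpace (Matrix.orthogonalGroup ι ℝ)]
    (ψ : ι → ℂ) :
    IsOrthogonallyInvariant (Measure.haarMeasure
      (⊤ : TopologicalSpace.PositiveCompacts (Matrix.orthogonalGroup ι ℝ)))
      (fun O => (O : Matrix ι ι ℝ).map (fun x : ℝ => (x : ℂ)) *ᵥ ψ) := by
  intro V hV f _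
  have := integral_mul_left_eq_self (μ := Measure.haarMeasure
      (⊤ : TopologicalSpace.PositiveCompacts (Matrix.orthogonalGroup ι ℝ)))
    (fun O : Matrix.orthogonalGroup ι ℝ =>
      f ((O : Matrix ι ι ℝ).map (fun x : ℝ => (x : ℂ)) *ᵥ ψ)) ⟨V, hV⟩
  rw [← this]
  congr 1
  ext O
  rw [Matrix.mulVec_mulVec]
  congr 2
  exact (Matrix.map_mul (f := Complex.ofRealHom)).symm

/-- Real orthogonal matrices preserve the bilinear form without conjugation, so q is constant along
each orbit. -/
theorem sum_map_mulVec_mul_self {ι : Type*} [Fintype ι] [DecidableEq ι] {O : Matrix ι ι ℝ}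
    (hO : O ∈ Matrix.orthogonalGroup ι ℝ) (ψ : ι → ℂ) :
    ∑ i, (O.map (fun x : ℝ => (x : ℂ)) *ᵥ ψ) i * (O.map (fun x : ℝ => (x : ℂ)) *ᵥ ψ) i =
      ∑ i, ψ i * ψ i := by
  have h : (O.map (fun x : ℝ => (x : ℂ)))ᵀ * O.map (fun x : ℝ => (x : ℂ)) = 1 := by
    have := (Matrix.mem_orthogonalGroup_iff' ι ℝ).mp hO
    have h2 := congrArg (fun M : Matrix ι ι ℝ => M.map Complex.ofRealHom) this
    rw [Matrix.map_mul] at h2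
    exact h2.trans (Matrix.map_one _ Complex.ofRealHom.map_zero Complex.ofRealHom.map_one)
  change (O.map (fun x : ℝ => (x : ℂ)) *ᵥ ψ) ⬝ᵥ (O.map (fun x : ℝ => (x : ℂ)) *ᵥ ψ) = ψ ⬝ᵥ ψ
  rw [Matrix.dotProduct_mulVec, Matrix.vecMul_mulVec, h, Matrix.vecMul_one]

/-- The mean one-tangle of a vector over the orthogonal group. -/
theorem haarMean_orthogonalGroup_oneTangle {d : ℕ} (hd : 2 ≤ d) {ψ : TripartiteIndex d d d → ℂ}
    (hψ : ∑ i, ψ i * conj (ψ i) = 1) :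
    ((haarMean (Matrix.orthogonalGroup (TripartiteIndex d d d) ℝ)
      (fun O => oneTangle ((O : Matrix (TripartiteIndex d d d) (TripartiteIndex d d d) ℝ).map (fun x : ℝ => (x : ℂ)) *ᵥ ψ)) : ℝ) : ℂ) =
      2 * (1 - (((d : ℂ) ^ 3 - (∑ i, ψ i * ψ i) * conj (∑ i, ψ i * ψ i)) * (d * (d + 1)) +
        (((d : ℂ) ^ 3 + 1) * ((∑ i, ψ i * ψ i) * conj (∑ i, ψ i * ψ i)) - 2)) /
        (((d : ℂ) ^ 3 + 2) * ((d : ℂ) ^ 3 - 1))) := by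
  let _ : MeasurableSpace (Matrix.orthogonalGroup (TripartiteIndex d d d) ℝ) := borel _
  have : BorelSpace (Matrix.orthogonalGroup (TripartiteIndex d d d) ℝ) := ⟨rfl⟩
  have hX := continuous_map_mulVec_coe ψ
  obtain ⟨β, γ, h1, h2, hm⟩ := fourthMoment_eq_of_isOrthogonallyInvariant hX
    (isOrthogonallyInvariant_haar ψ)
    (fun O => (sum_mulVec_mul_conj (map_ofReal_mem_unitaryGroup O.2) ψ).trans hψ)
  have hp : ∀ s : Fin 3, _ := fun s => integral_purity_of_fourthMoment hX
    (r := sliceIndex s) (sliceIndex_eq_iff s) hm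
  have h := integral_oneTangle (μ := Measure.haarMeasure
    (⊤ : TopologicalSpace.PositiveCompacts (Matrix.orthogonalGroup (TripartiteIndex d d d) ℝ))) hX
  simp only [hp] at h
  rw [haarMean_eq, h]
  simp only [sum_map_mulVec_mul_self (Subtype.prop _), integral_const, probReal_univ, one_smul] at h2
  set q := (∑ i, ψ i * ψ i) * conj (∑ i, ψ i * ψ i)
  have hd' : (2 : ℝ) ≤ d := by exact_mod_cast hd
  have h4 : (d : ℂ) ^ 3 - 1 ≠ 0 := by
    have : (d : ℝ) ^ 3 - 1 ≠ 0 := by nlinarith [sq_nonneg ((d : ℝ) - 1)]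
    exact_mod_cast this
  have h5 : (d : ℂ) ^ 3 + 2 ≠ 0 := by
    have : (d : ℝ) ^ 3 + 2 ≠ 0 := by positivity
    exact_mod_cast this
  simp only [Fintype.card_prod, Fintype.card_fin, Finset.sum_const, Finset.card_univ,
    nsmul_eq_mul] at h1 h2 ⊢
  push_cast at h1 h2 ⊢
  -- Elimination in the linear system for β and γ, whose determinant is n²(n + 2)(n - 1) with n =
  -- d³. It is singular for d = 1, which is treated separately.
  have e1 : β * (d : ℂ) ^ 3 * (((d : ℂ) ^ 3 + 2) * ((d : ℂ) ^ 3 - 1)) = (d : ℂ) ^ 3 - q := by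
    linear_combination (d : ℂ) ^ 3 * h1 - h2
  have e2 : γ * (d : ℂ) ^ 3 * (((d : ℂ) ^ 3 + 2) * ((d : ℂ) ^ 3 - 1)) = ((d : ℂ) ^ 3 + 1) * q - 2 := by
    linear_combination ((d : ℂ) ^ 3 + 1) * h2 - 2 * h1
  rw [← e1, ← e2]
  field_simp

theorem haarMean_orthogonalGroup_oneTangle_one {ψ : TripartiteIndex 1 1 1 → ℂ}
    (hψ : ∑ i, ψ i * conj (ψ i) = 1) :
    haarMean (Matrix.orthogonalGroup (TripartiteIndex 1 1 1) ℝ)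
      (fun O => oneTangle ((O : Matrix (TripartiteIndex 1 1 1) (TripartiteIndex 1 1 1) ℝ).map (fun x : ℝ => (x : ℂ)) *ᵥ ψ)) = 0 := by
  have h : ∀ χ : TripartiteIndex 1 1 1 → ℂ, ∑ i, χ i * conj (χ i) = 1 → oneTangle χ = 0 := by
    intro χ hχ
    have e : ∀ s, purity (fun p j => χ (sliceIndex s p j)) = 1 := by
      intro s
      have : χ (0, 0, 0) * conj (χ (0, 0, 0)) = 1 := by simpa [Fintype.sum_prod_type] using hχ
      have h0 : ∀ i, χ i = χ (0, 0, 0) := fun i => congrArg χ (Subsingleton.elim _ _)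
      simp [purity, h0, this]
    simp [oneTangle_eq, e]
  have h' : ∀ O : Matrix.orthogonalGroup (TripartiteIndex 1 1 1) ℝ,
      oneTangle ((O : Matrix (TripartiteIndex 1 1 1) (TripartiteIndex 1 1 1) ℝ).map (fun x : ℝ => (x : ℂ)) *ᵥ ψ) = 0 := fun O =>
    h _ ((sum_mulVec_mul_conj (map_ofReal_mem_unitaryGroup O.2) ψ).trans hψ)
  simp only [h']
  exact haarMean_const 0

theorem integral_sum_mul_self_uniformSphere {d : ℕ} (hd : 1 ≤ d) :
    ∫ φ : UnitVector d, (∑ i, φ.1.ofLp i * φ.1.ofLp i) * conj (∑ i, φ.1.ofLp i * φ.1.ofLp i)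
      ∂(uniformSphere d) = 2 / ((d : ℂ) + 1) := by
  rw [← sum_fourthMoment_cross (continuous_unitVector d)]
  simp only [fourthMoment_uniformSphere hd]
  have h1 : (d : ℂ) ≠ 0 := by exact_mod_cast (by omega : d ≠ 0)
  have h2 : (d : ℂ) + 1 ≠ 0 := by exact_mod_cast (by omega : d + 1 ≠ 0)
  simp [← Finset.mul_sum, Finset.sum_add_distrib]
  field_simp
  ring

theorem integral_sum_mul_self_productState {d : ℕ} (hd : 1 ≤ d) :
    ∫ φ, (∑ i, productState φ i * productState φ i) *
      conj (∑ i, productState φ i * productState φ i) ∂(uniformSphereTriple d) =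
      (2 / ((d : ℂ) + 1)) ^ 3 := by
  have e : ∀ φ : UnitVector d × UnitVector d × UnitVector d,
      ∑ i, productState φ i * productState φ i = (∑ i, φ.1.1.ofLp i * φ.1.1.ofLp i) *
      ((∑ i, φ.2.1.1.ofLp i * φ.2.1.1.ofLp i) * ∑ i, φ.2.2.1.ofLp i * φ.2.2.1.ofLp i) := by
    intro φ
    rw [Finset.sum_mul_sum (f := fun i => φ.2.1.1.ofLp i * φ.2.1.1.ofLp i)]
    rw [Finset.sum_mul]
    simp only [Fintype.sum_prod_type, productState, Finset.mul_sum]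
    refine Finset.sum_congr rfl fun i _ => Finset.sum_congr rfl fun j _ =>
      Finset.sum_congr rfl fun k _ => ?_
    ring
  have e' : ∀ a b c : ℂ, a * (b * c) * conj (a * (b * c)) =
      (a * conj a) * ((b * conj b) * (c * conj c)) := fun a b c => by
    simp only [map_mul]
    ring
  simp only [e, e']
  rw [uniformSphereTriple, integral_prod_mul
    (fun φ : UnitVector d => (∑ i, φ.1.ofLp i * φ.1.ofLp i) * conj (∑ i, φ.1.ofLp i * φ.1.ofLp i))
    (fun φ : UnitVector d × UnitVector d =>
      (∑ i, φ.1.1.ofLp i * φ.1.1.ofLp i) * conj (∑ i, φ.1.1.ofLp i * φ.1.1.ofLp i) *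
      ((∑ i, φ.2.1.ofLp i * φ.2.1.ofLp i) * conj (∑ i, φ.2.1.ofLp i * φ.2.1.ofLp i))),
    integral_prod_mul
    (fun φ : UnitVector d => (∑ i, φ.1.ofLp i * φ.1.ofLp i) * conj (∑ i, φ.1.ofLp i * φ.1.ofLp i))
    (fun φ : UnitVector d => (∑ i, φ.1.ofLp i * φ.1.ofLp i) * conj (∑ i, φ.1.ofLp i * φ.1.ofLp i)),
    integral_sum_mul_self_uniformSphere hd]
  ring

theorem haarMean_orthogonalGroup_entanglingPower {d : ℕ} (hd : 1 ≤ d) :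
    haarMean (Matrix.orthogonalGroup (TripartiteIndex d d d) ℝ)
        (fun O => entanglingPower
          ((O : Matrix (TripartiteIndex d d d) (TripartiteIndex d d d) ℝ).map
            (fun x : ℝ => (x : ℂ))))
      = 2 * (((d : ℝ) ^ 3 * ((d : ℝ) + 1) ^ 3 * ((d : ℝ) - 1) - 8 * ((d : ℝ) - 1)) /
          (((d : ℝ) ^ 3 + 2) * ((d : ℝ) ^ 2 + (d : ℝ) + 1) * ((d : ℝ) + 1) ^ 2)) := by
  have := isProbabilityMeasure_uniformSphereTriple hd
  rw [haarMean_entanglingPower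
    (continuous_subtype_val.matrix_map Complex.continuous_ofReal)]
  rcases hd.eq_or_lt with rfl | hd2
  · simp only [haarMean_orthogonalGroup_oneTangle_one (sum_productState_mul_conj _)]
    simp
  apply Complex.ofReal_injective
  rw [← integral_complex_ofReal]
  simp only [haarMean_orthogonalGroup_oneTangle hd2 (sum_productState_mul_conj _)]
  have hd' : (2 : ℝ) ≤ d := by exact_mod_cast hd2
  have hq : Integrable (fun φ : UnitVector d × UnitVector d × UnitVector d =>
      (∑ i, productState φ i * productState φ i) * conj (∑ i, productState φ i * productState φ i))
      (uniformSphereTriple d) := by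
    have h := fun i => (continuous_apply i).comp (continuous_productState (d := d))
    have hs : Continuous fun φ : UnitVector d × UnitVector d × UnitVector d =>
        ∑ i, productState φ i * productState φ i :=
      continuous_finsetSum _ fun i _ => (h i).mul (h i)
    exact (hs.mul (Complex.continuous_conj.comp hs)).integrable_of_compactSpace
  -- The mean one-tangle is split into a constant and a multiple of q, so only the mean of q is
  -- needed.
  have e : ∀ q : ℂ, 2 * (1 - (((d : ℂ) ^ 3 - q) * (d * (d + 1)) +
        (((d : ℂ) ^ 3 + 1) * q - 2)) / (((d : ℂ) ^ 3 + 2) * ((d : ℂ) ^ 3 - 1))) =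
      2 * (1 - ((d : ℂ) ^ 3 * (d * (d + 1)) - 2) / (((d : ℂ) ^ 3 + 2) * ((d : ℂ) ^ 3 - 1))) +
      -2 * (((d : ℂ) ^ 3 + 1 - d * (d + 1)) / (((d : ℂ) ^ 3 + 2) * ((d : ℂ) ^ 3 - 1))) * q :=
    fun q => by ring
  simp only [e]
  rw [integral_add (integrable_const _) (hq.const_mul _), integral_const, integral_const_mul,
    integral_sum_mul_self_productState hd]
  have h4 : (d : ℂ) - 1 ≠ 0 := by
    have : (d : ℝ) - 1 ≠ 0 := by linarith
    exact_mod_cast this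
  have h5 : (d : ℂ) ^ 3 + 2 ≠ 0 := by
    have : (d : ℝ) ^ 3 + 2 ≠ 0 := by positivity
    exact_mod_cast this
  have h7 : (d : ℂ) + 1 ≠ 0 := by exact_mod_cast (by omega : d + 1 ≠ 0)
  obtain ⟨D, hD⟩ : ∃ D : ℂ, (d : ℂ) ^ 2 + d + 1 = D := ⟨_, rfl⟩
  have h6 : D ≠ 0 := by
    have : (d : ℝ) ^ 2 + d + 1 ≠ 0 := by positivity
    rw [← hD]
    exact_mod_cast this
  have h8 : (d : ℂ) ^ 3 - 1 = (d - 1) * D := by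
    rw [← hD]
    ring
  simp only [probReal_univ, one_smul]
  push_cast
  rw [h8, hD]
  field_simp
  rw [← hD]
  ring

end OrthogonalMean

theorem haarMean_unitaryGroup_entanglingPower {d : ℕ} (hd : 1 ≤ d) :
    haarMean (Matrix.unitaryGroup (TripartiteIndex d d d) ℂ)
        (fun U => entanglingPower
          (U : Matrix (TripartiteIndex d d d) (TripartiteIndex d d d) ℂ))
      = 2 * (((d : ℝ) - 1) ^ 2 / ((d : ℝ) ^ 2 - (d : ℝ) + 1)) := by
  have := isProbabilityMeasure_uniformSphereTriple hd
  rw [haarMean_entanglingPower continuous_subtype_val]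
  simp only [haarMean_unitaryGroup_oneTangle hd (sum_productState_mul_conj _)]
  simp

/-! ### A unitary matrix all of whose balanced reductions are maximally mixed -/

section PrismMatrix

open ComplexConjugate

/-- The phase exponent of the graph state of the triangular prism. -/
def prismForm {R : Type*} [CommRing R] (x₁ x₂ x₃ y₁ y₂ y₃ : R) : R :=
  x₁ * x₂ + x₂ * x₃ + x₃ * x₁ + (y₁ * y₂ + y₂ * y₃ + y₃ * y₁) + (x₁ * y₁ + x₂ * y₂ + x₃ * y₃)

variable {d : ℕ} [NeZero d]

/-- A phase of modulus `d ^ (-3 / 2)`. -/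
noncomputable def phaseEntry (t : ZMod d) : ℂ :=
  ((√((d : ℝ) ^ 3))⁻¹ : ℝ) * ZMod.stdAddChar t

theorem phaseEntry_mul_conj (t u : ZMod d) :
    phaseEntry t * conj (phaseEntry u) = ((d : ℂ) ^ 3)⁻¹ * ZMod.stdAddChar (t - u) := by
  have h : ((((√((d : ℝ) ^ 3))⁻¹ : ℝ) : ℂ)) * (((√((d : ℝ) ^ 3))⁻¹ : ℝ) : ℂ) =
      ((d : ℂ) ^ 3)⁻¹ := by
    rw [← Complex.ofReal_mul, ← mul_inv, Real.mul_self_sqrt (by positivity)]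
    push_cast
    rfl
  rw [phaseEntry, phaseEntry, map_mul, Complex.conj_ofReal, ← AddChar.map_neg_eq_conj,
    sub_eq_add_neg, AddChar.map_add_eq_mul, ← h]
  ring

theorem sum_stdAddChar_finEquiv_mul (L : ZMod d) :
    ∑ w : Fin d, ZMod.stdAddChar (ZMod.finEquiv d w * L) = if L = 0 then (d : ℂ) else 0 := by
  refine (Equiv.sum_comp (ZMod.finEquiv d).toEquiv
    fun w => (ZMod.stdAddChar (w * L) : ℂ)).trans ?_
  rw [AddChar.sum_mulShift L (ZMod.isPrimitive_stdAddChar d), ZMod.card]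
  split_ifs <;> simp

/-- The inner product of two tensors of phases the exponents of which have an affine
difference. -/
theorem sum_phaseEntry_mul_conj {q q' : ZMod d → ZMod d → ZMod d → ZMod d}
    (hq : ∀ w₁ w₂ w₃, q w₁ w₂ w₃ - q' w₁ w₂ w₃ = q 0 0 0 - q' 0 0 0 +
      (w₁ * (q 1 0 0 - q' 1 0 0 - (q 0 0 0 - q' 0 0 0)) +
        w₂ * (q 0 1 0 - q' 0 1 0 - (q 0 0 0 - q' 0 0 0)) +
        w₃ * (q 0 0 1 - q' 0 0 1 - (q 0 0 0 - q' 0 0 0))))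
    {P : Prop} [Decidable P] (h : q 1 0 0 - q' 1 0 0 - (q 0 0 0 - q' 0 0 0) = 0 →
      q 0 1 0 - q' 0 1 0 - (q 0 0 0 - q' 0 0 0) = 0 →
      q 0 0 1 - q' 0 0 1 - (q 0 0 0 - q' 0 0 0) = 0 → P)
    (h' : P → q = q') :
    ∑ w₁ : Fin d, ∑ w₂ : Fin d, ∑ w₃ : Fin d,
      phaseEntry (q (ZMod.finEquiv d w₁) (ZMod.finEquiv d w₂) (ZMod.finEquiv d w₃)) *
      conj (phaseEntry (q' (ZMod.finEquiv d w₁) (ZMod.finEquiv d w₂) (ZMod.finEquiv d w₃))) =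
      if P then 1 else 0 := by
  simp only [phaseEntry_mul_conj]
  rw [Finset.sum_congr rfl fun w₁ _ => Finset.sum_congr rfl fun w₂ _ =>
    Finset.sum_congr rfl fun w₃ _ => by rw [hq]]
  -- The constant term and slopes of the affine difference. Character orthogonality makes each sum
  -- over w_i vanish unless its slope is zero; if all slopes vanish, the three factors d cancel the
  -- normalization d⁻³.
  set c := q 0 0 0 - q' 0 0 0 with hc
  set L₁ := q 1 0 0 - q' 1 0 0 - c with hL₁
  set L₂ := q 0 1 0 - q' 0 1 0 - c with hL₂
  set L₃ := q 0 0 1 - q' 0 0 1 - c with hL₃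
  simp only [AddChar.map_add_eq_mul, ← Finset.mul_sum, ← Finset.sum_mul,
    sum_stdAddChar_finEquiv_mul]
  have hd : (d : ℂ) ≠ 0 := by exact_mod_cast NeZero.ne d
  by_cases hP : P
  · have e := h' hP
    have hc₀ : c = 0 := by rw [hc, e, sub_self]
    have h₁ : L₁ = 0 := by rw [hL₁, hc₀, e, sub_self, sub_zero]
    have h₂ : L₂ = 0 := by rw [hL₂, hc₀, e, sub_self, sub_zero]
    have h₃ : L₃ = 0 := by rw [hL₃, hc₀, e, sub_self, sub_zero]
    simp only [hc₀, h₁, h₂, h₃, hP, if_true, AddChar.map_zero_eq_one]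
    field_simp
  · rw [if_neg hP]
    by_cases h₁ : L₁ = 0
    · by_cases h₂ : L₂ = 0
      · have h₃ : L₃ ≠ 0 := fun h₃ => hP (h h₁ h₂ h₃)
        simp [h₃]
      · simp [h₂]
    · simp [h₁]

/-- The matrix of the graph state of the triangular prism. -/
noncomputable def prismMatrix (d : ℕ) [NeZero d] :
    Matrix (TripartiteIndex d d d) (TripartiteIndex d d d) ℂ :=
  Matrix.of fun i k => phaseEntry (prismForm (ZMod.finEquiv d i.1) (ZMod.finEquiv d i.2.1)
    (ZMod.finEquiv d i.2.2) (ZMod.finEquiv d k.1) (ZMod.finEquiv d k.2.1) (ZMod.finEquiv d k.2.2))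

theorem prismMatrix_mem_unitaryGroup :
    prismMatrix d ∈ Matrix.unitaryGroup (TripartiteIndex d d d) ℂ := by
  rw [Matrix.mem_unitaryGroup_iff]
  ext ⟨i₁, i₂, i₃⟩ ⟨j₁, j₂, j₃⟩
  simp only [Matrix.mul_apply, Matrix.one_apply, Fintype.sum_prod_type, Matrix.star_apply,
    prismMatrix, Matrix.of_apply, Complex.star_def]
  set e := ZMod.finEquiv d
  refine sum_phaseEntry_mul_conj
    (q := fun w₁ w₂ w₃ => prismForm (e i₁) (e i₂) (e i₃) w₁ w₂ w₃)
    (q' := fun w₁ w₂ w₃ => prismForm (e j₁) (e j₂) (e j₃) w₁ w₂ w₃)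
    (fun w₁ w₂ w₃ => by simp only [prismForm]; ring) (fun h₁ h₂ h₃ => ?_) ?_
  · simp only [prismForm] at h₁ h₂ h₃
    rw [e.injective (by linear_combination h₁ : e i₁ = e j₁),
      e.injective (by linear_combination h₂ : e i₂ = e j₂),
      e.injective (by linear_combination h₃ : e i₃ = e j₃)]
  · simp only [Prod.mk.injEq]
    rintro ⟨rfl, rfl, rfl⟩
    rfl

/-- Terms quadratic in the summed variables cancel in the difference of exponents. The slopes are
the image of the differences of (c, k₁, k₂) under the adjacency block between kept and summed
vertices of the prism. Up to symmetry there are two blocks, according to whether the kept `x` vertex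
is joined to the summed `y` vertex. Both have determinant ±1, so zero slopes force equality even
when d is composite. The same holds for the other two pairs of inputs. -/
theorem sum_prismMatrix_first_second (s : Fin 3) (c k₁ k₂ c' k₁' k₂' : Fin d) :
    ∑ a : Fin d × Fin d, ∑ k₃, prismMatrix d (sliceIndex s a c) (k₁, k₂, k₃) *
      conj (prismMatrix d (sliceIndex s a c') (k₁', k₂', k₃)) =
      if c = c' ∧ k₁ = k₁' ∧ k₂ = k₂' then 1 else 0 := by
  simp only [prismMatrix, Matrix.of_apply, Fintype.sum_prod_type]
  have hinj : ∀ x y : Fin d, ZMod.finEquiv d x = ZMod.finEquiv d y → x = y := fun x y h =>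
    (ZMod.finEquiv d).injective h
  set e := ZMod.finEquiv d
  fin_cases s
  · refine sum_phaseEntry_mul_conj
      (q := fun w₁ w₂ w₃ => prismForm (e c) w₁ w₂ (e k₁) (e k₂) w₃)
      (q' := fun w₁ w₂ w₃ => prismForm (e c') w₁ w₂ (e k₁') (e k₂') w₃)
      (fun w₁ w₂ w₃ => by simp only [prismForm]; ring) (fun h₁ h₂ h₃ => ?_)
      (by rintro ⟨rfl, rfl, rfl⟩; rfl)
    simp only [prismForm] at h₁ h₂ h₃
    exact ⟨hinj _ _ (by grind), hinj _ _ (by grind), hinj _ _ (by grind)⟩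
  · refine sum_phaseEntry_mul_conj
      (q := fun w₁ w₂ w₃ => prismForm w₁ (e c) w₂ (e k₁) (e k₂) w₃)
      (q' := fun w₁ w₂ w₃ => prismForm w₁ (e c') w₂ (e k₁') (e k₂') w₃)
      (fun w₁ w₂ w₃ => by simp only [prismForm]; ring) (fun h₁ h₂ h₃ => ?_)
      (by rintro ⟨rfl, rfl, rfl⟩; rfl)
    simp only [prismForm] at h₁ h₂ h₃
    exact ⟨hinj _ _ (by grind), hinj _ _ (by grind), hinj _ _ (by grind)⟩
  · refine sum_phaseEntry_mul_conj
      (q := fun w₁ w₂ w₃ => prismForm w₁ w₂ (e c) (e k₁) (e k₂) w₃)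
      (q' := fun w₁ w₂ w₃ => prismForm w₁ w₂ (e c') (e k₁') (e k₂') w₃)
      (fun w₁ w₂ w₃ => by simp only [prismForm]; ring) (fun h₁ h₂ h₃ => ?_)
      (by rintro ⟨rfl, rfl, rfl⟩; rfl)
    simp only [prismForm] at h₁ h₂ h₃
    exact ⟨hinj _ _ (by grind), hinj _ _ (by grind), hinj _ _ (by grind)⟩

theorem sum_prismMatrix_first_third (s : Fin 3) (c k₁ k₃ c' k₁' k₃' : Fin d) :
    ∑ a : Fin d × Fin d, ∑ k₂, prismMatrix d (sliceIndex s a c) (k₁, k₂, k₃) *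
      conj (prismMatrix d (sliceIndex s a c') (k₁', k₂, k₃')) =
      if c = c' ∧ k₁ = k₁' ∧ k₃ = k₃' then 1 else 0 := by
  simp only [prismMatrix, Matrix.of_apply, Fintype.sum_prod_type]
  have hinj : ∀ x y : Fin d, ZMod.finEquiv d x = ZMod.finEquiv d y → x = y := fun x y h =>
    (ZMod.finEquiv d).injective h
  set e := ZMod.finEquiv d
  fin_cases s
  · refine sum_phaseEntry_mul_conj
      (q := fun w₁ w₂ w₃ => prismForm (e c) w₁ w₂ (e k₁) w₃ (e k₃))
      (q' := fun w₁ w₂ w₃ => prismForm (e c') w₁ w₂ (e k₁') w₃ (e k₃'))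
      (fun w₁ w₂ w₃ => by simp only [prismForm]; ring) (fun h₁ h₂ h₃ => ?_)
      (by rintro ⟨rfl, rfl, rfl⟩; rfl)
    simp only [prismForm] at h₁ h₂ h₃
    exact ⟨hinj _ _ (by grind), hinj _ _ (by grind), hinj _ _ (by grind)⟩
  · refine sum_phaseEntry_mul_conj
      (q := fun w₁ w₂ w₃ => prismForm w₁ (e c) w₂ (e k₁) w₃ (e k₃))
      (q' := fun w₁ w₂ w₃ => prismForm w₁ (e c') w₂ (e k₁') w₃ (e k₃'))
      (fun w₁ w₂ w₃ => by simp only [prismForm]; ring) (fun h₁ h₂ h₃ => ?_)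
      (by rintro ⟨rfl, rfl, rfl⟩; rfl)
    simp only [prismForm] at h₁ h₂ h₃
    exact ⟨hinj _ _ (by grind), hinj _ _ (by grind), hinj _ _ (by grind)⟩
  · refine sum_phaseEntry_mul_conj
      (q := fun w₁ w₂ w₃ => prismForm w₁ w₂ (e c) (e k₁) w₃ (e k₃))
      (q' := fun w₁ w₂ w₃ => prismForm w₁ w₂ (e c') (e k₁') w₃ (e k₃'))
      (fun w₁ w₂ w₃ => by simp only [prismForm]; ring) (fun h₁ h₂ h₃ => ?_)
      (by rintro ⟨rfl, rfl, rfl⟩; rfl)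
    simp only [prismForm] at h₁ h₂ h₃
    exact ⟨hinj _ _ (by grind), hinj _ _ (by grind), hinj _ _ (by grind)⟩

theorem sum_prismMatrix_second_third (s : Fin 3) (c k₂ k₃ c' k₂' k₃' : Fin d) :
    ∑ a : Fin d × Fin d, ∑ k₁, prismMatrix d (sliceIndex s a c) (k₁, k₂, k₃) *
      conj (prismMatrix d (sliceIndex s a c') (k₁, k₂', k₃')) =
      if c = c' ∧ k₂ = k₂' ∧ k₃ = k₃' then 1 else 0 := by
  simp only [prismMatrix, Matrix.of_apply, Fintype.sum_prod_type]
  have hinj : ∀ x y : Fin d, ZMod.finEquiv d x = ZMod.finEquiv d y → x = y := fun x y h =>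
    (ZMod.finEquiv d).injective h
  set e := ZMod.finEquiv d
  fin_cases s
  · refine sum_phaseEntry_mul_conj
      (q := fun w₁ w₂ w₃ => prismForm (e c) w₁ w₂ w₃ (e k₂) (e k₃))
      (q' := fun w₁ w₂ w₃ => prismForm (e c') w₁ w₂ w₃ (e k₂') (e k₃'))
      (fun w₁ w₂ w₃ => by simp only [prismForm]; ring) (fun h₁ h₂ h₃ => ?_)
      (by rintro ⟨rfl, rfl, rfl⟩; rfl)
    simp only [prismForm] at h₁ h₂ h₃
    exact ⟨hinj _ _ (by grind), hinj _ _ (by grind), hinj _ _ (by grind)⟩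
  · refine sum_phaseEntry_mul_conj
      (q := fun w₁ w₂ w₃ => prismForm w₁ (e c) w₂ w₃ (e k₂) (e k₃))
      (q' := fun w₁ w₂ w₃ => prismForm w₁ (e c') w₂ w₃ (e k₂') (e k₃'))
      (fun w₁ w₂ w₃ => by simp only [prismForm]; ring) (fun h₁ h₂ h₃ => ?_)
      (by rintro ⟨rfl, rfl, rfl⟩; rfl)
    simp only [prismForm] at h₁ h₂ h₃
    exact ⟨hinj _ _ (by grind), hinj _ _ (by grind), hinj _ _ (by grind)⟩
  · refine sum_phaseEntry_mul_conj
      (q := fun w₁ w₂ w₃ => prismForm w₁ w₂ (e c) w₃ (e k₂) (e k₃))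
      (q' := fun w₁ w₂ w₃ => prismForm w₁ w₂ (e c') w₃ (e k₂') (e k₃'))
      (fun w₁ w₂ w₃ => by simp only [prismForm]; ring) (fun h₁ h₂ h₃ => ?_)
      (by rintro ⟨rfl, rfl, rfl⟩; rfl)
    simp only [prismForm] at h₁ h₂ h₃
    exact ⟨hinj _ _ (by grind), hinj _ _ (by grind), hinj _ _ (by grind)⟩

/-- The entangling power of the prism matrix. -/
theorem entanglingPower_prismMatrix :
    entanglingPower (prismMatrix d) =
      2 * (((d : ℝ) ^ 2 + (d : ℝ) - 2) / (1 + (d : ℝ)) ^ 2) := by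
  have hd : 1 ≤ d := NeZero.one_le
  have hd' : (0 : ℝ) < d := by exact_mod_cast hd
  have h : ∀ s : Fin 3, _ := fun s => splitPurity_eq
    (M := fun p j k₁ k₂ k₃ => prismMatrix d (sliceIndex s p j) (k₁, k₂, k₃))
    (fun a c a' c' => by simp only [sum_mul_conj_row prismMatrix_mem_unitaryGroup, sliceIndex_eq_iff])
    (sum_prismMatrix_first_second s) (sum_prismMatrix_first_third s)
    (sum_prismMatrix_second_third s)
  have h' : ∀ s : Fin 3, (splitPurity fun p j k₁ k₂ k₃ =>
      prismMatrix d (sliceIndex s p j) (k₁, k₂, k₃)).re =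
      (d : ℝ) ^ 3 * ((d : ℝ) ^ 2 + 4 * d + 3) := by
    intro s
    have e : ((d : ℂ) ^ 3 * ((d : ℂ) ^ 2 + 4 * d + 3)) =
        (((d : ℝ) ^ 3 * ((d : ℝ) ^ 2 + 4 * d + 3) : ℝ) : ℂ) := by push_cast; rfl
    rw [h, ← Complex.ofReal_re ((d : ℝ) ^ 3 * ((d : ℝ) ^ 2 + 4 * d + 3)), ← e]
    congr 1
    simp only [Fintype.card_prod, Fintype.card_fin]
    push_cast
    ring
  rw [entanglingPower_eq hd]
  simp only [h', Finset.sum_const, Finset.card_univ, Fintype.card_fin, nsmul_eq_mul]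
  push_cast
  field_simp
  ring

end PrismMatrix

/-! ### The bound -/

theorem minBipartitionDim_const (d : ℕ) (c : Fin 3) (x : Finset (Fin 3)) :
    minBipartitionDim (fun _ => d) c x = min (d ^ (2 + x.card)) (d ^ (4 - x.card)) := by
  have hx : x.card ≤ 3 := x.card_le_univ
  simp only [minBipartitionDim, Finset.prod_const, Finset.card_compl, Fintype.card_fin,
    Finset.card_singleton]
  rw [← pow_add, ← pow_succ']
  congr 2
  omega

theorem entanglingPowerBound_const {d : ℕ} (hd : 1 ≤ d) :
    entanglingPowerBound (fun _ => d) =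
      2 * (((d : ℝ) ^ 2 + (d : ℝ) - 2) / (1 + (d : ℝ)) ^ 2) := by
  have hd' : (0 : ℝ) < d := by exact_mod_cast hd
  have hsum : ∀ f : ℕ → ℝ, ∑ x : Finset (Fin 3), f x.card = f 0 + 3 * f 1 + 3 * f 2 + f 3 := by
    intro f
    have := Finset.sum_powerset_apply_card f (x := (Finset.univ : Finset (Fin 3)))
    rw [Finset.powerset_univ] at this
    rw [this]
    simp [Finset.sum_range_succ, Nat.choose]
  have hb : ∀ c, bipartitionBound (fun _ => d) c =
      2 * (((d : ℝ) ^ 2 + (d : ℝ) - 2) / (1 + (d : ℝ)) ^ 2) := by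
    intro c
    have hmin : ∀ a b, a ≤ b → min (d ^ a) (d ^ b) = d ^ a := fun a b hab =>
      min_eq_left (Nat.pow_le_pow_right hd hab)
    have hmin' : ∀ a b, b ≤ a → min (d ^ a) (d ^ b) = d ^ b := fun a b hab =>
      min_eq_right (Nat.pow_le_pow_right hd hab)
    simp only [bipartitionBound, minBipartitionDim_const]
    -- For |x'| = 0, 1, 2, 3 the minimal exponents are 2, 3, 2, 1, with multiplicities 1, 3, 3, 1;
    -- the bracket is therefore 1/d² + 3/d³ + 3/d² + 1/d, as in the Cauchy–Schwarz bound.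
    rw [hsum fun n => (((min (d ^ (2 + n)) (d ^ (4 - n)) : ℕ) : ℝ) - 1) /
      ((min (d ^ (2 + n)) (d ^ (4 - n)) : ℕ) : ℝ), hmin (2 + 0) (4 - 0) (by norm_num),
      hmin (2 + 1) (4 - 1) (by norm_num), hmin' (2 + 2) (4 - 2) (by norm_num),
      hmin' (2 + 3) (4 - 3) (by norm_num)]
    simp only [Finset.prod_const, Finset.card_univ, Fintype.card_fin]
    push_cast
    norm_num
    field_simp
    ring
  simp only [entanglingPowerBound, hb, Finset.sum_const, Finset.card_univ, Fintype.card_fin,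
    nsmul_eq_mul]
  push_cast
  ring

theorem mainTheorem9 (d : ℕ) (hd : 1 ≤ d) :
    haarMean (Matrix.unitaryGroup (TripartiteIndex d d d) ℂ)
        (fun U => entanglingPower
          (U : Matrix (TripartiteIndex d d d) (TripartiteIndex d d d) ℂ))
      = 2 * (((d : ℝ) - 1) ^ 2 / ((d : ℝ) ^ 2 - (d : ℝ) + 1)) ∧
    haarMean (Matrix.orthogonalGroup (TripartiteIndex d d d) ℝ)
        (fun O => entanglingPower
          ((O : Matrix (TripartiteIndex d d d) (TripartiteIndex d d d) ℝ).map
            (fun x : ℝ => (x : ℂ))))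
      = 2 * (((d : ℝ) ^ 3 * ((d : ℝ) + 1) ^ 3 * ((d : ℝ) - 1) - 8 * ((d : ℝ) - 1)) /
          (((d : ℝ) ^ 3 + 2) * ((d : ℝ) ^ 2 + (d : ℝ) + 1) * ((d : ℝ) + 1) ^ 2)) ∧
    entanglingPowerBound (fun _ => d)
      = 2 * (((d : ℝ) ^ 2 + (d : ℝ) - 2) / (1 + (d : ℝ)) ^ 2) ∧
    IsGreatest
      (Set.range fun U : Matrix.unitaryGroup (TripartiteIndex d d d) ℂ =>
        entanglingPower (U : Matrix (TripartiteIndex d d d) (TripartiteIndex d d d) ℂ))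
      (2 * (((d : ℝ) ^ 2 + (d : ℝ) - 2) / (1 + (d : ℝ)) ^ 2)) := by
  have : NeZero d := ⟨by omega⟩
  refine ⟨haarMean_unitaryGroup_entanglingPower hd, haarMean_orthogonalGroup_entanglingPower hd,
    entanglingPowerBound_const hd, ⟨⟨prismMatrix d, prismMatrix_mem_unitaryGroup⟩,
      entanglingPower_prismMatrix⟩, ?_⟩
  rintro _ ⟨U, rfl⟩
  exact entanglingPower_le hd U.2
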